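/- Let $\mathbb H_n=\mathbb C^n\times\mathbb R$ be the Heisenberg group with the law $(z,s)(\tilde z,\tilde s)=(z+\tilde z,\,s+\tilde s+\tfrac12\operatorname{Im}\langle z,\tilde z\rangle)$ and Lebesgue measure, with convolution $(J*f)(p)=\int_{\mathbb H_n}J(pq^{-1})f(q)\,dq$. Let $\Omega\subset\mathbb H_n$ be a bounded domain (nonempty, open, connected), and let $J:\mathbb H_n\to\mathbb R$ be continuous, invariant under the action $g\cdot(z,s)=(gz,s)$ of the unitary group $U(n)$, symmetric in $s$ (that is, $J(z,-s)=J(z,s)$), and integrable with $\int_{\mathbb H_n}J=1$. A solution of the nonlocal Dirichlet problem with initial datum $u_0$ and exterior datum $0$ is a function $u\in C([0,\infty);L^1(\Omega))$, extended by $0$ outside $\Omega$, such that $u(0)=u_0$ and $u_t=J*u-u$ in $\Omega$ for $t>0$ (as an equation in $L^1(\Omega)$). Put $$\lambda_1=\inf_{w}\frac{\tfrac12\int_{\mathbb H_n}\int_{\mathbb H_n}J(pq^{-1})\,(w(p)-w(q))^2\,dp\,dq}{\int_\Omega w^2},$$ the infimum being over all nonzero $w\in L^2(\Omega)$, extended by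 $0$ outside $\Omega$. An eigenfunction associated to $\lambda_1$ is a nonzero $\varphi\in L^2(\Omega)$, extended by $0$ outside $\Omega$, with $\varphi-J*\varphi=\lambda_1\varphi$ a.e. in $\Omega$. 1. If $u_0\in L^1(\Omega)\cap L^2(\Omega)$, then every solution satisfies $\|u(\cdot,t)\|_{L^2(\Omega)}\le e^{-\lambda_1t}\|u_0\|_{L^2(\Omega)}$ for all $t\ge0$. 2. Suppose moreover that $J\ge0$. Then $\lambda_1>0$. If $u_0$ is continuous, positive and bounded on $\Omega$, and $u$ is a solution with initial datum $u_0$, then there is a constant $C>0$ with $\|u(\cdot,t)\|_{L^\infty(\Omega)}\le Ce^{-\lambda_1t}$ for all $t\ge0$, and there are a non-negative eigenfunction $\varphi$ associated to $\lambda_1$, continuous on $\Omega$, and a constant $\tilde C>0$ with $$\lim_{t\to\infty}\|e^{\lambda_1t}u(\cdot,t)-\tilde C\varphi\|_{L^\infty(\Omega)}=0.$$ 3. Suppose moreover that $J\ge0$ and $J(0,0)>0$. Then there is an eigenfunction $\varphi_1$ associated to $\lambda_1$ that is continuous and positive on $\Omega$; every eigenfunction associated to $\lambda_1$ is a.e.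 a constant multiple of $\varphi_1$; and for every continuous, positive and bounded $u_0$ on $\Omega$ and every solution $u$ with initial datum $u_0$ there is a constant $\tilde C>0$ with $$\lim_{t\to\infty}\|e^{\lambda_1t}u(\cdot,t)-\tilde C\varphi_1\|_{L^\infty(\Omega)}=0.$$ -/

import Mathlib

open MeasureTheory Filter Topology
open scoped ENNReal

noncomputable section

/-- The underlying space `ℂⁿ × ℝ` of the Heisenberg group `ℍₙ`, with its usual topology,
bounded sets and Lebesgue measure (`volume`), which is a Haar measure of the group. -/
abbrev Heis (n : ℕ) : Type := (Fin n → ℂ) × ℝ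

/-- The group law `(z, s)(z', s') = (z + z', s + s' + ½ Im⟨z, z'⟩)`, where
`⟨z, z'⟩ = ∑ j, conj (z j) * z' j` is the Hermitian inner product of `ℂⁿ`. -/
def Heis.mul {n : ℕ} (p q : Heis n) : Heis n :=
  (p.1 + q.1, p.2 + q.2 + (1 / 2) * (∑ j, starRingEnd ℂ (p.1 j) * q.1 j).im)

/-- The inverse `(z, s)⁻¹ = (-z, -s)` of the group law. -/
def Heis.inv {n : ℕ} (p : Heis n) : Heis n := (-p.1, -p.2)

/-- The kernel `K(p, q) = J(p q⁻¹) = J(z - z', s - s' - ½ Im⟨z, z'⟩)`, for `p = (z, s)` and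
`q = (z', s')`. -/
def heisKernel {n : ℕ} (J : Heis n → ℝ) (p q : Heis n) : ℝ := J (p.mul q.inv)

/-- The convolution `(J ∗ f)(p) = ∫ J(p q⁻¹) f(q) dq` of the Heisenberg group. -/
def heisConv {n : ℕ} (J f : Heis n → ℝ) (p : Heis n) : ℝ := ∫ q, heisKernel J p q * f q

/-- `J` is invariant under the action `g · (z, s) = (g z, s)` of `U(n)`, and has integral `1`
(in particular it is integrable). -/
structure HypH {n : ℕ} (J : Heis n → ℝ) : Prop where
  invariant : ∀ g ∈ Matrix.unitaryGroup (Fin n) ℂ, ∀ (z : Fin n → ℂ) (s : ℝ),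
    J (g.mulVec z, s) = J (z, s)
  integrable : Integrable J
  integral_eq_one : ∫ p, J p = 1

/-- `u` is a solution of the nonlocal Dirichlet problem
`u_t = J ∗ u - u` in `Ω` for `t > 0`, `u = 0` outside `Ω`, `u(0) = u₀` in `Ω`:
a continuous curve `[0, ∞) → L¹(Ω)` which satisfies the equation in `L¹(Ω)` at every time `t > 0`.
In the convolution, `u(t)` is taken to be zero outside `Ω`. -/
structure IsDirichletSolution {n : ℕ} (J : Heis n → ℝ) (Ω : Set (Heis n)) (u₀ : Heis n → ℝ)
    (u : ℝ → Lp ℝ 1 (volume.restrict Ω)) : Prop where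
  continuousOn : ContinuousOn u (Set.Ici 0)
  equation : ∀ t : ℝ, 0 < t → ∃ v : Lp ℝ 1 (volume.restrict Ω),
    (∀ᵐ p ∂(volume.restrict Ω), v p = heisConv J (Ω.indicator (u t)) p - u t p) ∧
    HasDerivAt u v t
  initial : ∀ᵐ p ∂(volume.restrict Ω), u 0 p = u₀ p

/-- The Dirichlet form `½ ∫∫ J(p q⁻¹) (w(p) - w(q))² dp dq` over `ℍₙ × ℍₙ`. -/
def dirichletForm {n : ℕ} (J : Heis n → ℝ) (w : Heis n → ℝ) : ℝ :=
  (1 / 2) * ∫ p, ∫ q, heisKernel J p q * (w p - w q) ^ 2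

/-- The first eigenvalue `λ₁(Ω)`: the infimum of the Rayleigh quotient over the nonzero
`w ∈ L²(Ω)`, extended by zero outside `Ω`. -/
def firstEigenvalue {n : ℕ} (J : Heis n → ℝ) (Ω : Set (Heis n)) : ℝ :=
  sInf {r : ℝ | ∃ w : Heis n → ℝ, MemLp w 2 ∧ (∀ p ∉ Ω, w p = 0) ∧
    (∫ p in Ω, w p ^ 2) ≠ 0 ∧ r = dirichletForm J w / ∫ p in Ω, w p ^ 2}

/-- `φ` is an eigenfunction associated to the first eigenvalue: a nonzero element of `L²(Ω)`,
extended by zero outside `Ω`, with `φ - J ∗ φ = λ₁ φ` in `Ω`. -/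
structure IsFirstEigenfunction {n : ℕ} (J : Heis n → ℝ) (Ω : Set (Heis n)) (φ : Heis n → ℝ) :
    Prop where
  memLp : MemLp φ 2
  eq_zero : ∀ p ∉ Ω, φ p = 0
  ne_zero : ¬ φ =ᵐ[volume] 0
  equation : ∀ᵐ p ∂(volume.restrict Ω), φ p - heisConv J φ p = firstEigenvalue J Ω * φ p

end

/-! Let `A` be `f ↦ J ∗ f` on `L²(Ω)`. Inversion in the group is `p ↦ -p`, and `-1` is unitary, so
the two symmetries make `J` even, the kernel `J(p q⁻¹)` symmetric and `A` self-adjoint. The kernel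
is continuous and `closure Ω` compact, so `A` is compact and even factors through a map `L¹ → L^∞`.
As `∫ J = 1`, the Dirichlet form is `‖w‖² - ⟪A w, w⟫`; hence `c = 1 - λ₁` is the supremum of the
Rayleigh quotient of `A`. Solutions are `e^{-t} e^{tA} u₀`, and `⟪A x, x⟫ ≤ c ‖x‖²` gives the `L²`
decay (`norm_exp_smul_apply_le`).

Let `J ≥ 0`. If `c > 0`, compactness makes `c` an eigenvalue (`exists_eigenvector_of_sup_inner`),
and absolute values of eigenvectors are eigenvectors. A value `c ≥ 1` is excluded by a maximum
principle (`eq_zero_of_le_kernelIntegral`): the maximum set would be compact and stable under `p ↦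
a⁻¹ p` whenever `J a > 0`, which forces `a = 0` and contradicts `∫ J = 1`.

For `c > 0` the rescaled semigroup converges strongly in `L²` to the projection onto the top
eigenspace; positivity makes the limit non-negative and nonzero, and the smoothing `L² → L^∞` of `A`
upgrades the convergence (`tendsto_Linfty_of_tendsto_L2`). For `c ≤ 0` the kernel vanishes on `Ω ×
Ω`, so `A = 0`, `c = 0` and `u₀` is itself an eigenfunction.

If `J 0 > 0`, the zero set in `Ω` of a non-negative eigenfunction is open and closed, so
connectedness gives positivity, and cancelling two eigenfunctions at one point gives simplicity. -/

set_option linter.unusedSectionVars false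

noncomputable section

/-! ### Linear equations with bounded operators -/

section LinearODE

variable {X Y : Type*} [NormedAddCommGroup X] [NormedSpace ℝ X] [CompleteSpace X]
  [NormedAddCommGroup Y] [NormedSpace ℝ Y] [CompleteSpace Y]

theorem hasDerivAt_exp_smul_apply (A : X →L[ℝ] X) (x : X) (t : ℝ) :
    HasDerivAt (fun s : ℝ => NormedSpace.exp (s • A) x) (A (NormedSpace.exp (t • A) x)) t := by
  have h := (hasDerivAt_exp_smul_const' A t).clm_apply (hasDerivAt_const t x)
  simpa using h

/-- Uniqueness for the linear equation `u' = A u`, differentiable on `(0, ∞)` only. -/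
theorem eq_exp_smul_apply_of_hasDerivAt (A : X →L[ℝ] X) (u : ℝ → X)
    (hc : ContinuousOn u (Set.Ici 0)) (hd : ∀ t, 0 < t → HasDerivAt u (A (u t)) t)
    {t : ℝ} (ht : 0 ≤ t) : u t = NormedSpace.exp (t • A) (u 0) := by
  rcases ht.eq_or_lt with rfl | ht
  · simp
  -- This curve joins `e^{tA} u(0)` at `s = 0` to `u(t)` at `s = t`, and its derivative vanishes for
  -- `s > 0`.
  set h : ℝ → X := fun s => NormedSpace.exp ((t - s) • A) (u s) with hh
  have hexp : ∀ s : ℝ, HasDerivAt (fun s : ℝ => NormedSpace.exp ((t - s) • A))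
      (-(NormedSpace.exp ((t - s) • A) * A)) s := by
    intro s
    refine ((hasDerivAt_exp_smul_const A (t - s)).scomp s
      ((hasDerivAt_id s).const_sub t)).congr_deriv ?_
    simp
  have hder : ∀ s, 0 < s → HasDerivAt h 0 s := by
    intro s hs
    have := (hexp s).clm_apply (hd s hs)
    simpa using this
  have hconst : ∀ s ∈ Set.Ioo 0 t, h s = h t := by
    intro s hs
    refine (constant_of_has_deriv_right_zero (f := h) (a := s) (b := t) ?_ ?_ t
      ⟨hs.2.le, le_rfl⟩).symm
    · intro r hr
      exact (hder r (hs.1.trans_le hr.1)).continuousAt.continuousWithinAt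
    · intro r hr
      exact (hder r (hs.1.trans_le hr.1)).hasDerivWithinAt
  have hcont : ContinuousWithinAt h (Set.Ioi 0) 0 := by
    have h1 : ContinuousWithinAt u (Set.Ioi 0) 0 :=
      (hc 0 Set.self_mem_Ici).mono Set.Ioi_subset_Ici_self
    exact (hexp 0).continuousAt.continuousWithinAt.clm_apply h1
  -- There is no derivative at `0`; continuity of `u` there identifies the constant with `h 0`.
  have hlim : Tendsto h (𝓝[>] 0) (𝓝 (h t)) := by
    refine tendsto_const_nhds.congr' ?_
    filter_upwards [Ioo_mem_nhdsGT ht] with s hs using (hconst s hs).symm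
  have := tendsto_nhds_unique hlim hcont
  simpa [hh] using this

/-- Both sides solve `v' = B v` with the same initial value. This moves the semigroup between the
spaces `L^p(Ω)`. -/
theorem map_exp_smul_apply (A : X →L[ℝ] X) (B : Y →L[ℝ] Y) (j : X →L[ℝ] Y)
    (h : ∀ x, j (A x) = B (j x)) (x : X) {t : ℝ} (ht : 0 ≤ t) :
    j (NormedSpace.exp (t • A) x) = NormedSpace.exp (t • B) (j x) := by
  have hd : ∀ t, HasDerivAt (fun s : ℝ => j (NormedSpace.exp (s • A) x))
      (B (j (NormedSpace.exp (t • A) x))) t := by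
    intro t
    have := j.hasFDerivAt.comp_hasDerivAt t (hasDerivAt_exp_smul_apply A x t)
    rw [h] at this
    exact this
  have := eq_exp_smul_apply_of_hasDerivAt B (fun s : ℝ => j (NormedSpace.exp (s • A) x))
    (fun t _ => (hd t).continuousAt.continuousWithinAt) (fun t _ => hd t) ht
  simpa using this

theorem exp_smul_apply_eigenvector (A : X →L[ℝ] X) {x : X} {c : ℝ} (hx : A x = c • x)
    {t : ℝ} (ht : 0 ≤ t) : NormedSpace.exp (t • A) x = Real.exp (c * t) • x := by
  have hd : ∀ t : ℝ, HasDerivAt (fun s : ℝ => Real.exp (c * s) • x)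
      (A (Real.exp (c * t) • x)) t := by
    intro t
    have := (((hasDerivAt_id t).const_mul c).exp).smul_const x
    refine this.congr_deriv ?_
    rw [map_smul, hx, smul_smul]; simp
  have := eq_exp_smul_apply_of_hasDerivAt A (fun s : ℝ => Real.exp (c * s) • x)
    (fun t _ => (hd t).continuousAt.continuousWithinAt) (fun t _ => hd t) ht
  simpa using this.symm

/-- If `u' = A u - u` on `(0, ∞)`, then `u(t) = e^{-t} e^{tA} u(0)`. -/
theorem eq_exp_neg_smul_exp_smul_apply (A : X →L[ℝ] X) (u : ℝ → X)
    (hc : ContinuousOn u (Set.Ici 0)) (hd : ∀ t, 0 < t → HasDerivAt u (A (u t) - u t) t)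
    {t : ℝ} (ht : 0 ≤ t) : u t = Real.exp (-t) • NormedSpace.exp (t • A) (u 0) := by
  have h := eq_exp_smul_apply_of_hasDerivAt A (fun s => Real.exp s • u s)
    (Real.continuous_exp.continuousOn.smul hc) (fun s hs => ?_) ht
  · simp only [Real.exp_zero, one_smul] at h
    rw [← h, smul_smul, ← Real.exp_add]; simp
  · refine ((Real.hasDerivAt_exp s).smul (hd s hs)).congr_deriv ?_
    rw [map_smul, smul_sub]; abel

/-- A function whose derivative is `o(e^{ct})`, `c > 0`, is itself `o(e^{ct})`. -/
theorem tendsto_exp_smul_of_hasDerivAt {f F : ℝ → X} {c : ℝ} (hc : 0 < c)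
    (hf : ∀ t, 0 ≤ t → HasDerivAt f (F t) t)
    (hF : Tendsto (fun t => Real.exp (-(c * t)) * ‖F t‖) atTop (𝓝 0)) :
    Tendsto (fun t => Real.exp (-(c * t)) • f t) atTop (𝓝 0) := by
  rw [tendsto_zero_iff_norm_tendsto_zero, Metric.tendsto_atTop]
  intro ε hε
  -- Integrating `(ε c / 2) e^{ct}` produces `(ε / 2) e^{ct}`; the other `ε / 2` absorbs `‖f T‖`.
  have hε2 : 0 < ε * c / 2 := by positivity
  obtain ⟨T, hT0, hT⟩ : ∃ T : ℝ, 0 ≤ T ∧ ∀ t, T ≤ t → ‖F t‖ ≤ ε * c / 2 * Real.exp (c * t) := by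
    obtain ⟨T, hT⟩ := Metric.tendsto_atTop.1 hF _ hε2
    refine ⟨max T 0, le_max_right _ _, fun t ht => ?_⟩
    have h := (hT t ((le_max_left _ _).trans ht)).le
    rw [Real.dist_eq, sub_zero, abs_of_nonneg (by positivity), Real.exp_neg,
      inv_mul_le_iff₀ (Real.exp_pos _)] at h
    linarith
  have hB : ∀ t, T ≤ t → ‖f t‖ ≤ ‖f T‖ + ε / 2 * (Real.exp (c * t) - Real.exp (c * T)) := by
    intro t ht
    refine image_norm_le_of_norm_deriv_right_le_deriv_boundary (f := f) (f' := F) (a := T) (b := t)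
      (B := fun t => ‖f T‖ + ε / 2 * (Real.exp (c * t) - Real.exp (c * T)))
      (B' := fun t => ε * c / 2 * Real.exp (c * t)) ?_ ?_ (by simp) ?_ ?_ ⟨ht, le_rfl⟩
    · exact fun s hs => (hf s (hT0.trans hs.1)).continuousAt.continuousWithinAt
    · exact fun s hs => (hf s (hT0.trans hs.1)).hasDerivWithinAt
    · intro s
      have := ((((hasDerivAt_id s).const_mul c).exp.sub_const (Real.exp (c * T))).const_mul
        (ε / 2)).const_add (‖f T‖)
      refine this.congr_deriv ?_
      simp; ring
    · exact fun s hs => hT s hs.1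
  have hlim : Tendsto (fun t : ℝ => Real.exp (-(c * t)) * ‖f T‖) atTop (𝓝 0) := by
    have : Tendsto (fun t : ℝ => Real.exp (-(c * t))) atTop (𝓝 0) :=
      Real.tendsto_exp_neg_atTop_nhds_zero.comp (tendsto_id.const_mul_atTop hc)
    simpa using this.mul_const ‖f T‖
  obtain ⟨T', hT'⟩ := Metric.tendsto_atTop.1 hlim (ε / 2) (by positivity)
  refine ⟨max T T', fun t ht => ?_⟩
  have h1 := hB t ((le_max_left _ _).trans ht)
  have h2 := hT' t ((le_max_right _ _).trans ht)
  rw [Real.dist_eq, sub_zero, abs_of_nonneg (by positivity)] at h2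
  rw [Real.dist_eq, sub_zero, abs_of_nonneg (by positivity), norm_smul, Real.norm_eq_abs,
    abs_of_pos (Real.exp_pos _)]
  have h3 : Real.exp (-(c * t)) * Real.exp (c * t) = 1 := by rw [← Real.exp_add]; simp
  have h4 : Real.exp (-(c * t)) * ‖f t‖ ≤
      Real.exp (-(c * t)) * (‖f T‖ + ε / 2 * (Real.exp (c * t) - Real.exp (c * T))) := by gcongr
  have h5 : 0 < Real.exp (-(c * t)) * Real.exp (c * T) := by positivity
  nlinarith

end LinearODE

/-! ### Symmetric operators on a Hilbert space: top of the spectrum and semigroup -/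

section Hilbert

variable {H : Type*} [NormedAddCommGroup H] [InnerProductSpace ℝ H]

local notation "⟪" x ", " y "⟫" => inner ℝ x y

/-- The operator `B = c - A` is non-negative and bounded, so `B² ≤ M B`. Near-maximizers of the
Rayleigh quotient are therefore approximate eigenvectors. -/
theorem norm_sq_sub_le_of_inner_le {A : H →L[ℝ] H} (hA : A.IsSymmetric) {c : ℝ}
    (hc : ∀ x, ⟪A x, x⟫ ≤ c * ‖x‖ ^ 2) :
    ∃ M, 0 < M ∧ ∀ x, ‖A x - c • x‖ ^ 2 ≤ M * (c * ‖x‖ ^ 2 - ⟪A x, x⟫) := by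
  set B : H →L[ℝ] H := c • ContinuousLinearMap.id ℝ H - A with hB
  have hBx : ∀ x, B x = c • x - A x := fun x => by simp [hB]
  have hBs : ∀ x y, ⟪B x, y⟫ = ⟪x, B y⟫ := by
    intro x y
    have := hA x y
    simp only [ContinuousLinearMap.coe_coe] at this
    rw [hBx, hBx, inner_sub_left, inner_sub_right, inner_smul_left, inner_smul_right, this]; simp
  have hBi : ∀ x, ⟪B x, x⟫ = c * ‖x‖ ^ 2 - ⟪A x, x⟫ := by
    intro x
    rw [hBx, inner_sub_left, inner_smul_left, real_inner_self_eq_norm_sq]; simp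
  have hBp : ∀ x, 0 ≤ ⟪B x, x⟫ := fun x => by rw [hBi]; linarith [hc x]
  refine ⟨‖B‖ + 1, by positivity, fun x => ?_⟩
  rw [← hBi, norm_sub_rev, ← hBx]
  set M := ‖B‖ + 1 with hM
  have hM0 : 0 < M := by positivity
  -- Expanding the form of `B` at `M x - B x` gives the inequality without a square root of `B`.
  have h1 := hBp (M • x - B x)
  have h2 : ⟪B (M • x - B x), M • x - B x⟫ =
      M ^ 2 * ⟪B x, x⟫ - 2 * M * ‖B x‖ ^ 2 + ⟪B (B x), B x⟫ := by
    rw [map_sub, map_smul, inner_sub_left, inner_sub_right, inner_sub_right, inner_smul_left,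
      inner_smul_right, inner_smul_left, inner_smul_right, hBs (B x) x, real_inner_self_eq_norm_sq]
    simp; ring
  have h3 : ⟪B (B x), B x⟫ ≤ M * ‖B x‖ ^ 2 := by
    calc ⟪B (B x), B x⟫ ≤ ‖B (B x)‖ * ‖B x‖ := real_inner_le_norm _ _
      _ ≤ (‖B‖ * ‖B x‖) * ‖B x‖ := by gcongr; exact B.le_opNorm _
      _ ≤ (M * ‖B x‖) * ‖B x‖ := by gcongr; linarith
      _ = _ := by ring
  rw [h2] at h1
  have h4 : M * ‖B x‖ ^ 2 ≤ M * (M * ⟪B x, x⟫) := by nlinarith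
  exact le_of_mul_le_mul_left h4 hM0

theorem apply_eq_smul_of_inner_ge {A : H →L[ℝ] H} (hA : A.IsSymmetric) {c : ℝ}
    (hc : ∀ x, ⟪A x, x⟫ ≤ c * ‖x‖ ^ 2) {x : H} (hx : c * ‖x‖ ^ 2 ≤ ⟪A x, x⟫) : A x = c • x := by
  obtain ⟨M, hM, h⟩ := norm_sq_sub_le_of_inner_le hA hc
  have h1 := h x
  have h2 : ‖A x - c • x‖ ^ 2 ≤ 0 := h1.trans (by nlinarith)
  have : ‖A x - c • x‖ = 0 := by
    have := sq_nonneg ‖A x - c • x‖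
    exact pow_eq_zero_iff (two_ne_zero) |>.1 (le_antisymm h2 this)
  exact sub_eq_zero.1 (norm_eq_zero.1 this)

variable [CompleteSpace H]

/-- If `c ≠ 0` is not an eigenvalue of the compact `A`, then `A - c` is bounded below.
Near-maximizers violate this, since there `‖A x - c x‖²` is at most a multiple of `ε ‖x‖²`. -/
theorem exists_eigenvector_of_sup_inner {A : H →L[ℝ] H} (hA : A.IsSymmetric)
    (hK : IsCompactOperator A) {c : ℝ} (hc0 : 0 < c)
    (hc : ∀ x, ⟪A x, x⟫ ≤ c * ‖x‖ ^ 2)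
    (hc' : ∀ ε > 0, ∃ x, x ≠ 0 ∧ (c - ε) * ‖x‖ ^ 2 ≤ ⟪A x, x⟫) :
    ∃ x, x ≠ 0 ∧ A x = c • x := by
  by_contra! hne
  have hev : ¬ Module.End.HasEigenvalue (A : Module.End ℝ H) c := by
    intro h
    obtain ⟨x, hx⟩ := h.exists_hasEigenvector
    exact hne x hx.2 (by simpa using hx.apply_eq_smul)
  obtain ⟨κ, hκ⟩ := hK.antilipschitz_of_not_hasEigenvalue hc0.ne' hev
  obtain ⟨M, hM, h⟩ := norm_sq_sub_le_of_inner_le hA hc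
  have hb : ∀ x, ‖x‖ ^ 2 ≤ κ ^ 2 * (M * (c * ‖x‖ ^ 2 - ⟪A x, x⟫)) := by
    intro x
    have h1 := hκ.le_mul_dist x 0
    simp only [dist_zero_right, map_zero] at h1
    have h2 : ‖x‖ ^ 2 ≤ (κ * ‖A x - c • x‖) ^ 2 := by
      gcongr
      simpa using h1
    rw [mul_pow] at h2
    exact h2.trans (by gcongr; exact h x)
  -- This `ε` satisfies `κ² M ε < 1/2`; the `+ 1` covers `κ = 0`.
  obtain ⟨x, hx, hx2⟩ := hc' (1 / (2 * (κ ^ 2 * M + 1))) (by positivity)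
  have hxp : 0 < ‖x‖ ^ 2 := by positivity
  have h1 := hb x
  set e := 1 / (2 * ((κ : ℝ) ^ 2 * M + 1)) with he
  have h2 : e * (2 * ((κ : ℝ) ^ 2 * M + 1)) = 1 := by rw [he]; field_simp
  have h3 : ‖x‖ ^ 2 ≤ (κ : ℝ) ^ 2 * M * (e * ‖x‖ ^ 2) := by
    calc _ ≤ (κ : ℝ) ^ 2 * (M * (c * ‖x‖ ^ 2 - ⟪A x, x⟫)) := h1
      _ ≤ (κ : ℝ) ^ 2 * (M * (e * ‖x‖ ^ 2)) := by gcongr; linarith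
      _ = _ := by ring
  have h4 : 0 < e := by positivity
  nlinarith

/-- Energy estimate: `e^{-2ct} ‖v‖²` has derivative `2 e^{-2ct} (⟪A v, v⟫ - c ‖v‖²) ≤ 0`. The sign
of `c` plays no role. -/
theorem norm_exp_smul_apply_le {A : H →L[ℝ] H} {c : ℝ}
    (hc : ∀ x, ⟪A x, x⟫ ≤ c * ‖x‖ ^ 2) (x : H) {t : ℝ} (ht : 0 ≤ t) :
    ‖NormedSpace.exp (t • A) x‖ ≤ Real.exp (c * t) * ‖x‖ := by
  set v : ℝ → H := fun s => NormedSpace.exp (s • A) x with hv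
  have hd : ∀ s, HasDerivAt (fun s => Real.exp (-(2 * c) * s) * ‖v s‖ ^ 2)
      (Real.exp (-(2 * c) * s) * (-(2 * c)) * ‖v s‖ ^ 2 +
        Real.exp (-(2 * c) * s) * (2 * ⟪v s, A (v s)⟫)) s := by
    intro s
    have h1 := (hasDerivAt_exp_smul_apply A x s).norm_sq
    have h2 := ((hasDerivAt_id s).const_mul (-(2 * c))).exp
    refine (h2.mul h1).congr_deriv ?_
    simp [hv]
  have hanti : AntitoneOn (fun s => Real.exp (-(2 * c) * s) * ‖v s‖ ^ 2) Set.univ := by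
    refine antitoneOn_of_deriv_nonpos convex_univ
      (fun s _ => (hd s).continuousAt.continuousWithinAt)
      (fun s _ => (hd s).differentiableAt.differentiableWithinAt) (fun s _ => ?_)
    rw [(hd s).deriv, real_inner_comm]
    have := hc (v s)
    have h0 := Real.exp_pos (-(2 * c) * s)
    nlinarith
  have h := hanti (Set.mem_univ 0) (Set.mem_univ t) ht
  simp only [mul_zero, Real.exp_zero, one_mul, hv, zero_smul, NormedSpace.exp_zero,
    one_apply_eq_self] at h
  have h2 : ‖NormedSpace.exp (t • A) x‖ ^ 2 ≤ (Real.exp (c * t) * ‖x‖) ^ 2 := by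
    have h3 : Real.exp (2 * c * t) * Real.exp (-(2 * c) * t) = 1 := by
      rw [← Real.exp_add]; simp
    have h4 : Real.exp (c * t) ^ 2 = Real.exp (2 * c * t) := by
      rw [← Real.exp_nat_mul]; congr 1; push_cast; ring
    rw [mul_pow, h4]
    have h5 := mul_le_mul_of_nonneg_left h (Real.exp_pos (2 * c * t)).le
    rwa [← mul_assoc, h3, one_mul] at h5
  exact le_of_sq_le_sq h2 (by positivity)

/-- The rescaled semigroup of a compact symmetric operator converges strongly to the orthogonal
projection onto the eigenspace of the top of the spectrum. -/
theorem exists_tendsto_exp_smul_apply {A : H →L[ℝ] H} (hA : A.IsSymmetric)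
    (hK : IsCompactOperator A) {c : ℝ} (hc : ∀ x, ⟪A x, x⟫ ≤ c * ‖x‖ ^ 2) (x : H) :
    ∃ y, A y = c • y ∧ (∀ z, A z = c • z → ⟪y, z⟫ = ⟪x, z⟫) ∧
      Tendsto (fun t : ℝ => Real.exp (-(c * t)) • NormedSpace.exp (t • A) x) atTop (𝓝 y) := by
  set E : Submodule ℝ H := (A - c • ContinuousLinearMap.id ℝ H).ker with hE
  have hmem : ∀ z, z ∈ E ↔ A z = c • z := fun z => by simp [hE, sub_eq_zero]
  have : CompleteSpace E :=
    (A - c • ContinuousLinearMap.id ℝ H).isClosed_ker.completeSpace_coe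
  set P := E.starProjection with hP
  set S : ℝ → H → H := fun t x => Real.exp (-(c * t)) • NormedSpace.exp (t • A) x with hS
  have hSle : ∀ t, 0 ≤ t → ∀ x, ‖S t x‖ ≤ ‖x‖ := by
    intro t ht x
    have := norm_exp_smul_apply_le hc x ht
    simp only [hS, norm_smul, Real.norm_eq_abs, Real.abs_exp]
    rw [Real.exp_neg]
    rwa [inv_mul_le_iff₀ (Real.exp_pos _)]
  -- The vectors for which convergence holds form a subspace, closed because every `S t` with `t ≥
  -- 0` is a contraction. It contains all eigenspaces, so the spectral theorem makes it everything.
  let D : Submodule ℝ H :=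
    { carrier := {x | Tendsto (fun t => S t x) atTop (𝓝 (P x))}
      add_mem' := fun {a b} ha hb => by
        have := Tendsto.add ha hb
        simpa [hS] using this
      zero_mem' := by simp [hS]
      smul_mem' := fun r a ha => by
        have := Tendsto.const_smul ha r
        simpa [hS, smul_comm r] using this }
  have hDmem : ∀ x, x ∈ D ↔ Tendsto (fun t => S t x) atTop (𝓝 (P x)) := fun x => Iff.rfl
  have hDc : IsClosed (D : Set H) := by
    refine isClosed_of_closure_subset fun x hx => ?_
    rw [SetLike.mem_coe, hDmem, Metric.tendsto_atTop]
    intro ε hε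
    obtain ⟨y, hy, hxy⟩ := Metric.mem_closure_iff.1 hx (ε / 3) (by positivity)
    obtain ⟨T, hT⟩ := Metric.tendsto_atTop.1 ((hDmem y).1 hy) (ε / 3) (by positivity)
    refine ⟨max T 0, fun t ht => ?_⟩
    have h1 : dist (S t x) (S t y) ≤ dist x y := by
      rw [dist_eq_norm, dist_eq_norm]
      have h := hSle t ((le_max_right _ _).trans ht) (x - y)
      simp only [hS, map_sub, smul_sub] at h
      exact h
    have h2 := hT t ((le_max_left _ _).trans ht)
    have h3 : dist (P y) (P x) ≤ dist x y := by
      rw [dist_comm, dist_eq_norm, dist_eq_norm, ← map_sub]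
      exact E.norm_starProjection_apply_le _
    have := dist_triangle4 (S t x) (S t y) (P y) (P x)
    linarith
  have hDE : (⨆ r, Module.End.eigenspace (A : Module.End ℝ H) r) ≤ D := by
    refine iSup_le fun r z hz => ?_
    have hz : A z = r • z := by simpa using Module.End.mem_eigenspace_iff.1 hz
    rw [hDmem]
    by_cases hz0 : z = 0
    · simp [hz0, hS]
    have hSz : ∀ t, 0 ≤ t → S t z = Real.exp (-((c - r) * t)) • z := by
      intro t ht
      simp only [hS]
      rw [exp_smul_apply_eigenvector A hz ht, smul_smul, ← Real.exp_add]
      congr 2; ring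
    have hlim : Tendsto (fun t => Real.exp (-((c - r) * t)) • z) atTop (𝓝 (P z)) := by
      by_cases hr : r = c
      · subst hr
        rw [hP, E.starProjection_eq_self_iff.2 ((hmem z).2 hz)]
        simp
      · have hrc : r < c := by
          refine lt_of_le_of_ne ?_ hr
          have h1 := hc z
          rw [hz, inner_smul_left, real_inner_self_eq_norm_sq] at h1
          have : 0 < ‖z‖ ^ 2 := by positivity
          exact le_of_mul_le_mul_right h1 this
        have hPz : P z = 0 := by
          rw [hP, E.starProjection_apply_eq_zero_iff, Submodule.mem_orthogonal]
          intro w hw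
          have h1 := hA w z
          simp only [ContinuousLinearMap.coe_coe] at h1
          rw [(hmem w).1 hw, hz, inner_smul_left, inner_smul_right] at h1
          simp only [conj_trivial] at h1
          have : (c - r) * ⟪w, z⟫ = 0 := by linarith
          exact (mul_eq_zero.1 this).resolve_left (sub_ne_zero.2 (Ne.symm hr))
        rw [hPz, ← zero_smul ℝ z]
        exact (Real.tendsto_exp_neg_atTop_nhds_zero.comp
          (tendsto_id.const_mul_atTop (sub_pos.2 hrc))).smul_const z
    refine hlim.congr' ?_
    filter_upwards [eventually_ge_atTop 0] with t ht using (hSz t ht).symm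
  have htop : D = ⊤ := by
    have h1 := ContinuousLinearMap.orthogonalComplement_iSup_eigenspaces_eq_bot hK hA
    rw [← Submodule.topologicalClosure_eq_top_iff] at h1
    rw [eq_top_iff, ← h1]
    exact Submodule.topologicalClosure_minimal _ hDE hDc
  refine ⟨P x, (hmem _).1 (E.starProjection_apply_mem x), fun z hz => ?_, ?_⟩
  · have h1 := E.starProjection_inner_eq_zero x z ((hmem z).2 hz)
    rw [inner_sub_left] at h1
    linarith
  · have : x ∈ D := by rw [htop]; trivial
    exact this

end Hilbert

/-! ### Inclusions between the spaces `L^p` of a finite measure -/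

section LpInclusion

variable {X : Type*} [MeasurableSpace X] {μ : Measure X} [IsFiniteMeasure μ]

/-- The inclusion `L^q ⊆ L^p`, `p ≤ q`, of a finite measure. -/
def lpInclusion (μ : Measure X) [IsFiniteMeasure μ] {p q : ℝ≥0∞} [Fact (1 ≤ p)] [Fact (1 ≤ q)]
    (hpq : p ≤ q) : Lp ℝ q μ →L[ℝ] Lp ℝ p μ :=
  LinearMap.mkContinuous
    { toFun := fun f => ⟨f.1, Lp.antitone hpq f.2⟩
      map_add' := fun _ _ => rfl
      map_smul' := fun _ _ => rfl }
    (μ Set.univ ^ (1 / p.toReal - 1 / q.toReal)).toReal (fun f => by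
      have h := eLpNorm_le_eLpNorm_mul_rpow_measure_univ hpq (Lp.aestronglyMeasurable f)
      rw [Lp.norm_def, Lp.norm_def, ← ENNReal.toReal_mul, mul_comm]
      refine ENNReal.toReal_mono (ENNReal.mul_ne_top (Lp.eLpNorm_ne_top f) ?_) h
      refine ENNReal.rpow_ne_top_of_nonneg ?_ (measure_ne_top _ _)
      rw [sub_nonneg]
      rcases eq_or_ne q ∞ with rfl | hq
      · simp
      · have hp : p ≠ 0 := (zero_lt_one.trans_le Fact.out).ne'
        have h1 : 0 < p.toReal := ENNReal.toReal_pos hp (ne_top_of_le_ne_top hq hpq)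
        exact one_div_le_one_div_of_le h1 (ENNReal.toReal_mono hq hpq))

/-- The inclusion keeps the underlying class, so later intertwining relations between realizations
of one operator hold by `rfl`. -/
theorem coeFn_lpInclusion {p q : ℝ≥0∞} [Fact (1 ≤ p)] [Fact (1 ≤ q)]
    (hpq : p ≤ q) (f : Lp ℝ q μ) : (lpInclusion μ hpq f : X → ℝ) = f := rfl

theorem lpInclusion_injective {p q : ℝ≥0∞} [Fact (1 ≤ p)] [Fact (1 ≤ q)]
    (hpq : p ≤ q) : Function.Injective (lpInclusion μ hpq) := by
  intro f g h
  apply Lp.ext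
  rw [← coeFn_lpInclusion hpq, h, coeFn_lpInclusion]

end LpInclusion

/-! ### Integral operators with a continuous kernel -/

section Kernel

variable {X : Type*} [MetricSpace X] [ProperSpace X] [MeasurableSpace X] [BorelSpace X]
  {μ : Measure X} [IsFiniteMeasure μ] {K : X → X → ℝ} {S : Set X}

/-- The integral operator `f ↦ ∫ K(·, q) f(q) dμ(q)` with kernel `K`. -/
def kernelIntegral (K : X → X → ℝ) (μ : Measure X) (f : X → ℝ) (p : X) : ℝ :=
  ∫ q, K p q * f q ∂μ

theorem kernelIntegral_congr_ae {f g : X → ℝ} (hfg : f =ᵐ[μ] g) :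
    kernelIntegral K μ f = kernelIntegral K μ g := by
  ext p
  refine integral_congr_ae ?_
  filter_upwards [hfg] with q hq
  rw [hq]

theorem exists_forall_abs_kernel_le (hK : Continuous (Function.uncurry K)) {C S : Set X}
    (hC : IsCompact C) (hS : IsCompact S) : ∃ M, 0 ≤ M ∧ ∀ p ∈ C, ∀ q ∈ S, |K p q| ≤ M := by
  obtain ⟨M, hM⟩ := (hC.prod hS).exists_bound_of_continuousOn hK.continuousOn
  exact ⟨max M 0, le_max_right _ _, fun p hp q hq => (hM (p, q) ⟨hp, hq⟩).trans (le_max_left _ _)⟩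

theorem integrable_kernel_mul (hK : Continuous (Function.uncurry K)) (hS : IsCompact S)
    (hμ : ∀ᵐ p ∂μ, p ∈ S) {f : X → ℝ} (hf : Integrable f μ) (p : X) :
    Integrable (fun q => K p q * f q) μ := by
  obtain ⟨M, -, hM⟩ := exists_forall_abs_kernel_le hK (isCompact_singleton (x := p)) hS
  refine hf.bdd_mul (c := M) ?_ ?_
  · exact (hK.comp (Continuous.prodMk_right p)).aestronglyMeasurable
  · filter_upwards [hμ] with q hq using hM p rfl q hq

theorem continuous_kernelIntegral (hK : Continuous (Function.uncurry K)) (hS : IsCompact S)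
    (hμ : ∀ᵐ p ∂μ, p ∈ S) {f : X → ℝ} (hf : Integrable f μ) :
    Continuous (kernelIntegral K μ f) := by
  rw [continuous_iff_continuousAt]
  intro p
  obtain ⟨M, -, hM⟩ := exists_forall_abs_kernel_le hK (isCompact_closedBall p 1) hS
  refine continuousAt_of_dominated (bound := fun q => M * |f q|) ?_ ?_ (hf.abs.const_mul M) ?_
  · exact Eventually.of_forall fun p' => (integrable_kernel_mul hK hS hμ hf p').aestronglyMeasurable
  · filter_upwards [Metric.closedBall_mem_nhds p one_pos] with p' hp'
    filter_upwards [hμ] with q hq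
    rw [Real.norm_eq_abs, abs_mul]
    gcongr
    exact hM p' hp' q hq
  · refine Eventually.of_forall fun q => ?_
    exact ((hK.comp (Continuous.prodMk_left q)).mul continuous_const).continuousAt

theorem L1_norm_eq_integral_abs (f : Lp ℝ 1 μ) : ‖f‖ = ∫ q, |f q| ∂μ := by
  simpa using L1.norm_eq_integral_norm f

theorem abs_kernelIntegral_le {M : ℝ} {p : X} (hμ : ∀ᵐ p ∂μ, p ∈ S)
    (hM : ∀ q ∈ S, |K p q| ≤ M) (f : Lp ℝ 1 μ) : |kernelIntegral K μ f p| ≤ M * ‖f‖ := by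
  rw [L1_norm_eq_integral_abs, ← integral_const_mul, ← Real.norm_eq_abs]
  refine norm_integral_le_of_norm_le ((L1.integrable_coeFn f).abs.const_mul M) ?_
  filter_upwards [hμ] with q hq
  rw [Real.norm_eq_abs, abs_mul]
  gcongr
  exact hM q hq

/-- The integral operator as a map from `L¹` to continuous functions on a compact set. -/
def kernelToContinuous (hK : Continuous (Function.uncurry K)) (hS : IsCompact S)
    (hμ : ∀ᵐ p ∂μ, p ∈ S) : Lp ℝ 1 μ →L[ℝ] BoundedContinuousFunction S ℝ :=
  haveI : CompactSpace S := isCompact_iff_compactSpace.1 hS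
  LinearMap.mkContinuousOfExistsBound
    { toFun := fun f => BoundedContinuousFunction.mkOfCompact
        ⟨fun p => kernelIntegral K μ f p,
          (continuous_kernelIntegral hK hS hμ (L1.integrable_coeFn f)).comp continuous_subtype_val⟩
      map_add' := fun f g => by
        ext p
        simp only [BoundedContinuousFunction.mkOfCompact_apply, ContinuousMap.coe_mk,
          BoundedContinuousFunction.coe_add, Pi.add_apply, kernelIntegral]
        rw [← integral_add (integrable_kernel_mul hK hS hμ (L1.integrable_coeFn f) p)
          (integrable_kernel_mul hK hS hμ (L1.integrable_coeFn g) p)]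
        refine integral_congr_ae ?_
        filter_upwards [Lp.coeFn_add f g] with q hq
        rw [hq, Pi.add_apply, mul_add]
      map_smul' := fun c f => by
        ext p
        simp only [BoundedContinuousFunction.mkOfCompact_apply, ContinuousMap.coe_mk,
          BoundedContinuousFunction.coe_smul, kernelIntegral, RingHom.id_apply, smul_eq_mul]
        rw [← integral_const_mul]
        refine integral_congr_ae ?_
        filter_upwards [Lp.coeFn_smul c f] with q hq
        rw [hq, Pi.smul_apply, smul_eq_mul]
        ring }
    (by
      obtain ⟨M, hM0, hM⟩ := exists_forall_abs_kernel_le hK hS hS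
      refine ⟨M, fun f => ?_⟩
      rw [BoundedContinuousFunction.norm_le (by positivity)]
      exact fun p => abs_kernelIntegral_le hμ (hM p p.2) f)

/-- Arzelà–Ascoli: on the unit ball of `L¹`, the bound on `K` over `S × S` bounds the images, and
its uniform continuity gives them a common modulus. -/
theorem isCompactOperator_kernelToContinuous (hK : Continuous (Function.uncurry K))
    (hS : IsCompact S) (hμ : ∀ᵐ p ∂μ, p ∈ S) :
    IsCompactOperator (kernelToContinuous hK hS hμ) := by
  have : CompactSpace S := isCompact_iff_compactSpace.1 hS
  refine (isCompactOperator_iff_isCompact_closure_image_closedBall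
    (kernelToContinuous hK hS hμ).toLinearMap one_pos).2 ?_
  obtain ⟨M, hM0, hM⟩ := exists_forall_abs_kernel_le hK hS hS
  refine BoundedContinuousFunction.arzela_ascoli (Metric.closedBall 0 M)
    (isCompact_closedBall _ _) _ ?_ ?_
  · rintro _ p ⟨f, hf, rfl⟩
    rw [mem_closedBall_zero_iff] at hf ⊢
    exact (abs_kernelIntegral_le hμ (hM p p.2) f).trans (mul_le_of_le_one_right hM0 hf)
  · refine UniformEquicontinuous.equicontinuous (Metric.uniformEquicontinuous_iff.2 fun ε hε => ?_)
    have huc : UniformContinuous (fun x : S × S => K x.1 x.2) :=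
      CompactSpace.uniformContinuous_of_continuous
        (hK.comp (continuous_subtype_val.prodMap continuous_subtype_val))
    obtain ⟨δ, hδ, h⟩ := Metric.uniformContinuous_iff.1 huc (ε / 2) (by positivity)
    refine ⟨δ, hδ, ?_⟩
    rintro p p' hpp ⟨_, f, hf, rfl⟩
    rw [mem_closedBall_zero_iff] at hf
    have h1 : kernelIntegral K μ f p - kernelIntegral K μ f p' =
        kernelIntegral (fun x q => K p q - K p' q) μ f p := by
      simp only [kernelIntegral]
      rw [← integral_sub (integrable_kernel_mul hK hS hμ (L1.integrable_coeFn f) p)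
        (integrable_kernel_mul hK hS hμ (L1.integrable_coeFn f) p')]
      simp only [sub_mul]
    have h2 : |kernelIntegral (fun x q => K p q - K p' q) μ f (p : X)| ≤ ε / 2 * ‖f‖ := by
      refine abs_kernelIntegral_le (S := S) hμ (fun q hq => ?_) f
      refine (h (a := (p, ⟨q, hq⟩)) (b := (p', ⟨q, hq⟩)) ?_).le
      rw [Prod.dist_eq]
      simp [hpp]
    change dist (kernelIntegral K μ f p) (kernelIntegral K μ f p') < ε
    rw [Real.dist_eq, h1]
    nlinarith

theorem norm_extend_zero_le (f : BoundedContinuousFunction S ℝ) (p : X) :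
    ‖Function.extend (Subtype.val : S → X) f 0 p‖ ≤ ‖f‖ := by
  by_cases hp : ∃ s : S, (s : X) = p
  · obtain ⟨s, rfl⟩ := hp
    rw [Subtype.val_injective.extend_apply]
    exact f.norm_coe_le_norm s
  · rw [Function.extend_apply' _ _ _ hp]
    simp

theorem memLp_extend_zero (hS : IsCompact S) (μ : Measure X) (f : BoundedContinuousFunction S ℝ) :
    MemLp (Function.extend (Subtype.val : S → X) f 0) ∞ μ :=
  memLp_top_of_bound ((MeasurableEmbedding.subtype_coe hS.measurableSet).measurable_extend
    f.continuous.measurable measurable_const).aestronglyMeasurable ‖f‖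
    (Eventually.of_forall (norm_extend_zero_le f))

/-- Extension by zero of continuous functions on a compact set to elements of `L^∞`. -/
def continuousToLinfty (hS : IsCompact S) (μ : Measure X) :
    BoundedContinuousFunction S ℝ →L[ℝ] Lp ℝ ∞ μ :=
  LinearMap.mkContinuous
    { toFun := fun f => (memLp_extend_zero hS μ f).toLp _
      map_add' := fun f g => by
        rw [← MemLp.toLp_add]
        refine MemLp.toLp_congr _ _ (Eventually.of_forall fun p => ?_)
        by_cases hp : ∃ s : S, (s : X) = p
        · obtain ⟨s, rfl⟩ := hp
          simp
        · simp [Function.extend_apply' _ _ _ hp]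
      map_smul' := fun c f => by
        rw [RingHom.id_apply, ← MemLp.toLp_const_smul]
        refine MemLp.toLp_congr _ _ (Eventually.of_forall fun p => ?_)
        by_cases hp : ∃ s : S, (s : X) = p
        · obtain ⟨s, rfl⟩ := hp
          simp
        · simp [Function.extend_apply' _ _ _ hp] } 1 (fun f => by
      rw [one_mul]
      refine (Lp.norm_toLp _ (memLp_extend_zero hS μ f)).le.trans ?_
      refine ENNReal.toReal_le_of_le_ofReal (norm_nonneg _) ?_
      rw [eLpNorm_exponent_top]
      exact eLpNormEssSup_le_of_ae_bound (Eventually.of_forall (norm_extend_zero_le f)))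

theorem coeFn_continuousToLinfty (hS : IsCompact S) (hμ : ∀ᵐ p ∂μ, p ∈ S)
    (f : BoundedContinuousFunction S ℝ) :
    ∀ᵐ p ∂μ, ∃ h : p ∈ S, continuousToLinfty hS μ f p = f ⟨p, h⟩ := by
  have : continuousToLinfty hS μ f =ᵐ[μ] Function.extend (Subtype.val : S → X) f 0 :=
    (memLp_extend_zero hS μ f).coeFn_toLp
  filter_upwards [hμ, this] with p hp h
  exact ⟨hp, h.trans (Subtype.val_injective.extend_apply f 0 ⟨p, hp⟩)⟩

/-- The integral operator with a continuous kernel as a map `L¹ → L^∞`. -/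
def kernelOp (hK : Continuous (Function.uncurry K)) (hS : IsCompact S)
    (hμ : ∀ᵐ p ∂μ, p ∈ S) : Lp ℝ 1 μ →L[ℝ] Lp ℝ ∞ μ :=
  (continuousToLinfty hS μ).comp (kernelToContinuous hK hS hμ)

theorem coeFn_kernelOp (hK : Continuous (Function.uncurry K)) (hS : IsCompact S)
    (hμ : ∀ᵐ p ∂μ, p ∈ S) (f : Lp ℝ 1 μ) : kernelOp hK hS hμ f =ᵐ[μ] kernelIntegral K μ f := by
  filter_upwards [coeFn_continuousToLinfty hS hμ (kernelToContinuous hK hS hμ f)] with p hp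
  obtain ⟨h, h'⟩ := hp
  exact h'

theorem isCompactOperator_kernelOp (hK : Continuous (Function.uncurry K)) (hS : IsCompact S)
    (hμ : ∀ᵐ p ∂μ, p ∈ S) : IsCompactOperator (kernelOp hK hS hμ) :=
  (isCompactOperator_kernelToContinuous hK hS hμ).clm_comp (continuousToLinfty hS μ)

/-- The integral operator on `L¹`. -/
def kernelOpL1 (hK : Continuous (Function.uncurry K)) (hS : IsCompact S)
    (hμ : ∀ᵐ p ∂μ, p ∈ S) : Lp ℝ 1 μ →L[ℝ] Lp ℝ 1 μ :=
  (lpInclusion μ le_top).comp (kernelOp hK hS hμ)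

/-- The integral operator on `L²`. -/
def kernelOpL2 (hK : Continuous (Function.uncurry K)) (hS : IsCompact S)
    (hμ : ∀ᵐ p ∂μ, p ∈ S) : Lp ℝ 2 μ →L[ℝ] Lp ℝ 2 μ :=
  (lpInclusion μ le_top).comp ((kernelOp hK hS hμ).comp (lpInclusion μ one_le_two))

/-- The integral operator on `L^∞`. -/
def kernelOpLinfty (hK : Continuous (Function.uncurry K)) (hS : IsCompact S)
    (hμ : ∀ᵐ p ∂μ, p ∈ S) : Lp ℝ ∞ μ →L[ℝ] Lp ℝ ∞ μ :=
  (kernelOp hK hS hμ).comp (lpInclusion μ le_top)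

theorem coeFn_kernelOpL1 (hK : Continuous (Function.uncurry K)) (hS : IsCompact S)
    (hμ : ∀ᵐ p ∂μ, p ∈ S) (f : Lp ℝ 1 μ) : kernelOpL1 hK hS hμ f =ᵐ[μ] kernelIntegral K μ f :=
  coeFn_kernelOp hK hS hμ f

theorem coeFn_kernelOpL2 (hK : Continuous (Function.uncurry K)) (hS : IsCompact S)
    (hμ : ∀ᵐ p ∂μ, p ∈ S) (f : Lp ℝ 2 μ) : kernelOpL2 hK hS hμ f =ᵐ[μ] kernelIntegral K μ f :=
  coeFn_kernelOp hK hS hμ (lpInclusion μ one_le_two f)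

theorem isCompactOperator_kernelOpL2 (hK : Continuous (Function.uncurry K)) (hS : IsCompact S)
    (hμ : ∀ᵐ p ∂μ, p ∈ S) : IsCompactOperator (kernelOpL2 hK hS hμ) :=
  ((isCompactOperator_kernelOp hK hS hμ).comp_clm (lpInclusion μ one_le_two)).clm_comp
    (lpInclusion μ (le_top : (2 : ℝ≥0∞) ≤ ∞))

theorem integrable_coeFn_L2 (f : Lp ℝ 2 μ) : Integrable f μ :=
  (Lp.memLp f).integrable one_le_two

theorem inner_kernelOpL2 (hK : Continuous (Function.uncurry K)) (hS : IsCompact S)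
    (hμ : ∀ᵐ p ∂μ, p ∈ S) (f g : Lp ℝ 2 μ) :
    inner ℝ (kernelOpL2 hK hS hμ f) g = ∫ p, kernelIntegral K μ f p * g p ∂μ := by
  rw [L2.inner_def]
  refine integral_congr_ae ?_
  filter_upwards [coeFn_kernelOpL2 hK hS hμ f] with p hp
  rw [hp]; simp [mul_comm]

/-- Fubini, applicable because `K` is bounded on `S × S` and `f`, `g` are integrable. -/
theorem isSymmetric_kernelOpL2 (hK : Continuous (Function.uncurry K)) (hS : IsCompact S)
    (hμ : ∀ᵐ p ∂μ, p ∈ S) (hsymm : ∀ p q, K p q = K q p) :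
    (kernelOpL2 hK hS hμ).IsSymmetric := by
  intro f g
  simp only [ContinuousLinearMap.coe_coe]
  rw [real_inner_comm (kernelOpL2 hK hS hμ g) f, inner_kernelOpL2, inner_kernelOpL2]
  obtain ⟨M, hM0, hM⟩ := exists_forall_abs_kernel_le hK hS hS
  have hint : Integrable (Function.uncurry fun p q => K p q * f q * g p) (μ.prod μ) := by
    have h1 : Integrable (fun z : X × X => g z.1 * f z.2) (μ.prod μ) :=
      (integrable_coeFn_L2 g).mul_prod (integrable_coeFn_L2 f)
    have h2 : Integrable (fun z : X × X => Function.uncurry K z * (g z.1 * f z.2)) (μ.prod μ) := by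
      refine h1.bdd_mul (c := M) hK.aestronglyMeasurable ?_
      have := (Measure.quasiMeasurePreserving_fst (μ := μ) (ν := μ)).ae hμ
      filter_upwards [this, (Measure.quasiMeasurePreserving_snd (μ := μ) (ν := μ)).ae hμ]
        with z h1 h2 using hM z.1 h1 z.2 h2
    refine h2.congr (Eventually.of_forall fun z => ?_)
    simp only [Function.uncurry]; ring
  simp only [kernelIntegral, ← integral_mul_const]
  rw [integral_integral_swap hint]
  congr! 4 with q p
  rw [hsymm]; ring

section Positive

variable (hK : Continuous (Function.uncurry K)) (hS : IsCompact S)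
  (hμ : ∀ᵐ p ∂μ, p ∈ S) (hpos : ∀ p q, 0 ≤ K p q)

include hpos

theorem kernelIntegral_nonneg {f : X → ℝ} (hf : 0 ≤ᵐ[μ] f) (p : X) : 0 ≤ kernelIntegral K μ f p := by
  refine integral_nonneg_of_ae ?_
  filter_upwards [hf] with q hq using mul_nonneg (hpos p q) hq

theorem kernelOpL2_nonneg {f : Lp ℝ 2 μ} (hf : 0 ≤ f) : 0 ≤ kernelOpL2 hK hS hμ f := by
  rw [← Lp.coeFn_nonneg] at hf ⊢
  filter_upwards [coeFn_kernelOpL2 hK hS hμ f] with p hp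
  rw [hp]
  exact kernelIntegral_nonneg hpos hf p

/-- Each term of the exponential series is a non-negative multiple of a power of a positive
operator. -/
theorem exp_smul_kernelOpL2_nonneg {f : Lp ℝ 2 μ} (hf : 0 ≤ f) {t : ℝ} (ht : 0 ≤ t) :
    0 ≤ NormedSpace.exp (t • kernelOpL2 hK hS hμ) f := by
  set A := kernelOpL2 hK hS hμ
  have h := (NormedSpace.exp_series_hasSum_exp' (𝕂 := ℝ) (t • A)).mapL
    (ContinuousLinearMap.apply ℝ (Lp ℝ 2 μ) f)
  refine h.nonneg fun n => ?_
  have h2 : ∀ n : ℕ, 0 ≤ (A ^ n) f := by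
    intro n
    induction n with
    | zero => simpa using hf
    | succ n ih =>
      rw [pow_succ']
      exact kernelOpL2_nonneg hK hS hμ hpos ih
  simp only [ContinuousLinearMap.apply_apply, smul_pow, smul_apply]
  rw [← Lp.coeFn_nonneg]
  have h3 := (Lp.coeFn_nonneg _).2 (h2 n)
  rw [smul_smul]
  filter_upwards [Lp.coeFn_smul (((n.factorial : ℝ)⁻¹) * t ^ n) ((A ^ n) f), h3] with p hp hp3
  rw [hp]
  exact mul_nonneg (by positivity) hp3

/-- For a non-negative kernel, `|∫ K f| ≤ ∫ K |f|` pointwise. Hence maximizers may be replaced by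
their absolute values. -/
theorem inner_kernelOpL2_le_abs (f : Lp ℝ 2 μ) :
    inner ℝ (kernelOpL2 hK hS hμ f) f ≤ inner ℝ (kernelOpL2 hK hS hμ |f|) |f| := by
  rw [L2.inner_def, L2.inner_def]
  refine integral_mono_ae (L2.integrable_inner _ _) (L2.integrable_inner _ _) ?_
  filter_upwards [coeFn_kernelOpL2 hK hS hμ f, coeFn_kernelOpL2 hK hS hμ |f|, Lp.coeFn_abs f]
    with p h1 h2 h3
  have h4 : |kernelIntegral K μ f p| ≤ kernelIntegral K μ (|f| : Lp ℝ 2 μ) p := by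
    simp only [kernelIntegral, ← Real.norm_eq_abs]
    refine (norm_integral_le_integral_norm _).trans (le_of_eq (integral_congr_ae ?_))
    filter_upwards [Lp.coeFn_abs f] with q hq
    rw [hq, norm_mul, Real.norm_of_nonneg (hpos p q), Real.norm_eq_abs]
  simp only [RCLike.inner_apply, conj_trivial, h1, h2, h3]
  calc _ ≤ |f p * kernelIntegral K μ f p| := le_abs_self _
    _ ≤ _ := by rw [abs_mul]; gcongr

end Positive

end Kernel

/-! ### The Heisenberg kernel, the Dirichlet form and the Rayleigh quotient -/

section HeisKernel

variable {n : ℕ} {J : Heis n → ℝ}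

theorem heisKernel_eq (J : Heis n → ℝ) (p q : Heis n) :
    heisKernel J p q =
      J (p.1 - q.1, p.2 - (1 / 2) * (∑ j, starRingEnd ℂ (p.1 j) * q.1 j).im - q.2) := by
  simp only [heisKernel, Heis.mul, Heis.inv, Pi.neg_apply, mul_neg, Finset.sum_neg_distrib,
    Complex.neg_im]
  congr 2
  ring

theorem HypH.apply_neg (hJ : HypH J)
    (hJs : ∀ (z : Fin n → ℂ) (s : ℝ), J (z, -s) = J (z, s)) (h : Heis n) : J (-h) = J h := by
  have h1 := hJ.invariant (-1) (by
    rw [Matrix.mem_unitaryGroup_iff]; simp) h.1 h.2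
  rw [Matrix.neg_mulVec, Matrix.one_mulVec] at h1
  rw [← h1, ← hJs (-h.1)]
  rfl

/-- The elements `p q⁻¹` and `q p⁻¹` are mutually inverse, in coordinates because `Im⟨z, z'⟩` is
antisymmetric. -/
theorem heisKernel_symm (hJn : ∀ h, J (-h) = J h) (p q : Heis n) :
    heisKernel J p q = heisKernel J q p := by
  rw [heisKernel_eq, heisKernel_eq, ← hJn]
  congr 1
  have h1 : (∑ j, starRingEnd ℂ (q.1 j) * p.1 j).im = -(∑ j, starRingEnd ℂ (p.1 j) * q.1 j).im := by
    rw [← Complex.conj_im, map_sum]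
    congr 2
    ext j
    rw [map_mul, Complex.conj_conj, mul_comm]
  ext1
  · simp
  · simp only [Prod.snd_neg, h1]; ring

theorem heisKernel_self (J : Heis n → ℝ) (p : Heis n) : heisKernel J p p = J 0 := by
  rw [heisKernel_eq]
  congr 1
  ext1
  · simp
  · simp only [← Complex.normSq_eq_conj_mul_self]
    simp

/-- If `J` charges a point `a`, a nonempty compact set stable under `p ↦ a⁻¹ p` forces `a = 0`. -/
theorem eq_zero_of_heisKernel_mapsTo {Z : Set (Heis n)} (hZ : IsCompact Z) (hne : Z.Nonempty)
    (hstep : ∀ p ∈ Z, ∀ q, 0 < heisKernel J p q → q ∈ Z) {a : Heis n} (ha : 0 < J a) : a = 0 := by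
  -- The point is `q = a⁻¹ p`, for which `p q⁻¹ = a`.
  have key : ∀ p ∈ Z, ((p.1 - a.1, p.2 - (1 / 2) *
      (∑ j, starRingEnd ℂ (p.1 j) * (p.1 - a.1) j).im - a.2) : Heis n) ∈ Z := by
    intro p hp
    refine hstep p hp _ ?_
    rw [heisKernel_eq]
    simpa using ha
  have h1 : a.1 = 0 := by
    ext1 j
    by_contra hj
    -- The translation lowers this functional by `|a_j|²`, which is impossible at its minimum.
    obtain ⟨p, hp, hmin⟩ := hZ.exists_isMinOn hne
      (f := fun p : Heis n => (starRingEnd ℂ (a.1 j) * p.1 j).re)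
      (by fun_prop)
    have := hmin (key p hp)
    simp only [Set.mem_ofPred_eq, Pi.sub_apply, mul_sub, Complex.sub_re] at this
    rw [← Complex.normSq_eq_conj_mul_self, Complex.ofReal_re] at this
    have := Complex.normSq_pos.2 hj
    linarith
  have h2 : a.2 = 0 := by
    by_contra hj
    -- With `a.1 = 0` the symplectic term vanishes, and `a.2 * p.2` drops by `a.2²`.
    obtain ⟨p, hp, hmin⟩ := hZ.exists_isMinOn hne (f := fun p : Heis n => a.2 * p.2)
      (by fun_prop)
    have := hmin (key p hp)
    have h0 : (∑ j, starRingEnd ℂ (p.1 j) * (p.1 - a.1) j).im = 0 := by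
      simp only [h1, sub_zero, ← Complex.normSq_eq_conj_mul_self]
      simp
    simp only [Set.mem_ofPred_eq, h0, mul_zero, sub_zero, mul_sub] at this
    have : 0 < a.2 * a.2 := mul_self_pos.2 hj
    linarith
  exact Prod.ext h1 h2

theorem continuous_heisKernel (hJc : Continuous J) :
    Continuous (Function.uncurry (heisKernel J)) := by
  have : Function.uncurry (heisKernel J) = fun x : Heis n × Heis n => J (x.1.1 - x.2.1,
      x.1.2 - (1 / 2) * (∑ j, starRingEnd ℂ (x.1.1 j) * x.2.1 j).im - x.2.2) := by
    ext x
    exact heisKernel_eq J x.1 x.2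
  rw [this]
  refine hJc.comp (Continuous.prodMk (by fun_prop) ?_)
  refine Continuous.sub (Continuous.sub (by fun_prop) (continuous_const.mul ?_)) (by fun_prop)
  refine Complex.continuous_im.comp (continuous_finsetSum _ fun j _ => ?_)
  exact (Complex.continuous_conj.comp (by fun_prop)).mul (by fun_prop)

/-- The map `q ↦ p q⁻¹` preserves Lebesgue measure. -/
theorem measurePreserving_mul_inv (p : Heis n) :
    MeasurePreserving (fun q : Heis n => ((p.1 - q.1,
      p.2 - (1 / 2) * (∑ j, starRingEnd ℂ (p.1 j) * q.1 j).im - q.2) : Heis n)) := by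
  refine MeasurePreserving.skew_product (f := fun z : Fin n → ℂ => p.1 - z)
    (g := fun z s => p.2 - (1 / 2) * (∑ j, starRingEnd ℂ (p.1 j) * z j).im - s)
    (Measure.measurePreserving_sub_left volume p.1) ?_ ?_
  · refine Continuous.measurable ?_
    refine Continuous.sub (Continuous.sub (by fun_prop) (continuous_const.mul ?_)) (by fun_prop)
    refine Complex.continuous_im.comp (continuous_finsetSum _ fun j _ => ?_)
    fun_prop
  · exact Eventually.of_forall fun z => (Measure.measurePreserving_sub_left volume _).map_eq

theorem integrable_heisKernel_right (hJ : Integrable J) (p : Heis n) :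
    Integrable (fun q => heisKernel J p q) := by
  simp only [heisKernel_eq]
  exact (measurePreserving_mul_inv p).integrable_comp_of_integrable hJ

theorem integral_comp_heisKernel_right (hJc : Continuous J) {f : ℝ → ℝ} (hf : Continuous f)
    (p : Heis n) : ∫ q, f (heisKernel J p q) = ∫ h, f (J h) := by
  simp only [heisKernel_eq]
  have h := (measurePreserving_mul_inv p)
  rw [← integral_map h.measurable.aemeasurable (f := fun h => f (J h)), h.map_eq]
  exact (hf.comp hJc).aestronglyMeasurable

variable {Ω : Set (Heis n)}

theorem heisConv_indicator (hΩ : MeasurableSet Ω) (f : Heis n → ℝ) (p : Heis n) :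
    heisConv J (Ω.indicator f) p = kernelIntegral (heisKernel J) (volume.restrict Ω) f p := by
  rw [heisConv, kernelIntegral, ← integral_indicator hΩ]
  congr 1
  ext q
  by_cases hq : q ∈ Ω <;> simp [hq]

theorem heisConv_of_eq_zero (hΩ : MeasurableSet Ω) {f : Heis n → ℝ} (hf : ∀ p ∉ Ω, f p = 0)
    (p : Heis n) :
    heisConv J f p = kernelIntegral (heisKernel J) (volume.restrict Ω) f p := by
  rw [← heisConv_indicator hΩ, Set.indicator_eq_self.2 (Function.support_subset_iff'.2 hf)]

theorem integrable_of_restrict {f : Heis n → ℝ} (hf : ∀ p ∉ Ω, f p = 0)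
    (h : Integrable f (volume.restrict Ω)) : Integrable f :=
  (integrableOn_iff_integrable_of_support_subset (Function.support_subset_iff'.2 hf)).1 h

theorem setIntegral_of_eq_zero {f : Heis n → ℝ} (hf : ∀ p ∉ Ω, f p = 0) :
    ∫ p in Ω, f p = ∫ p, f p :=
  setIntegral_eq_integral_of_forall_compl_eq_zero hf

theorem ae_restrict_mem_closure (hΩ : MeasurableSet Ω) :
    ∀ᵐ p ∂(volume.restrict Ω), p ∈ closure Ω := by
  filter_upwards [ae_restrict_mem hΩ] with p hp using subset_closure hp

/-- The Dirichlet form is `∫_Ω w² - ∫_Ω (J ∗ w) w`. -/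
theorem dirichletForm_eq [IsFiniteMeasure (volume.restrict Ω)] (hJc : Continuous J)
    (hJn : ∀ h, J (-h) = J h) (hJi : Integrable J)
    (hJ1 : ∫ h, J h = 1) (hΩ : MeasurableSet Ω) (hS : IsCompact (closure Ω)) {w : Heis n → ℝ}
    (hw : MemLp w 2) (hw0 : ∀ p ∉ Ω, w p = 0) :
    dirichletForm J w = (∫ p in Ω, w p ^ 2) -
      ∫ p in Ω, kernelIntegral (heisKernel J) (volume.restrict Ω) w p * w p := by
  set K := heisKernel J with hKdef
  set k := kernelIntegral K (volume.restrict Ω) w with hk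
  have hK := continuous_heisKernel hJc
  have hμ := ae_restrict_mem_closure hΩ
  have hwi : Integrable w (volume.restrict Ω) :=
    (hw.restrict Ω).integrable one_le_two
  have hw2 : Integrable (fun p => w p ^ 2) := hw.integrable_sq
  have hKw : ∀ p, Integrable (fun q => K p q * w q) := fun p =>
    integrable_of_restrict (fun q hq => by simp [hw0 q hq]) (integrable_kernel_mul hK hS hμ hwi p)
  have hKw2 : ∀ p, Integrable (fun q => K p q * w q ^ 2) := fun p =>
    integrable_of_restrict (fun q hq => by simp [hw0 q hq])
      (integrable_kernel_mul hK hS hμ hw2.restrict p)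
  have hKi : ∀ p, Integrable (fun q => K p q) := integrable_heisKernel_right hJi
  have hK1 : ∀ p, ∫ q, K p q = 1 := fun p => by
    rw [← hJ1]; exact integral_comp_heisKernel_right hJc continuous_id p
  -- Expansion of the square, with `∫ K p q dq = 1` for the first term.
  have hinner : ∀ p, ∫ q, K p q * (w p - w q) ^ 2 =
      w p ^ 2 - 2 * (k p * w p) + ∫ q, K p q * w q ^ 2 := by
    intro p
    have h1 : ∀ q, K p q * (w p - w q) ^ 2 =
        w p ^ 2 * K p q - 2 * w p * (K p q * w q) + K p q * w q ^ 2 := fun q => by ring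
    have hs : Integrable (fun q => w p ^ 2 * K p q - 2 * w p * (K p q * w q)) :=
      ((hKi p).const_mul _).sub ((hKw p).const_mul _)
    simp only [h1]
    rw [integral_add hs (hKw2 p),
      integral_sub ((hKi p).const_mul _) ((hKw p).const_mul _), integral_const_mul,
      integral_const_mul, hK1, hk, kernelIntegral,
      setIntegral_of_eq_zero (f := fun q => K p q * w q) (fun q hq => by simp [hw0 q hq])]
    ring
  have hkw : Integrable (fun p => k p * w p) := by
    refine integrable_of_restrict (Ω := Ω) (fun q hq => by simp [hw0 q hq]) ?_
    have hkc : Continuous k := continuous_kernelIntegral hK hS hμ hwi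
    obtain ⟨M, hM⟩ := hS.exists_bound_of_continuousOn hkc.continuousOn
    refine hwi.bdd_mul (c := M) hkc.aestronglyMeasurable ?_
    filter_upwards [hμ] with p hp using hM p hp
  -- Integrating in `p` first turns the kernel, by symmetry, into the constant `‖J‖₁`.
  have hprod : Integrable (Function.uncurry fun p q => K p q * w q ^ 2) (volume.prod volume) := by
    rw [integrable_prod_iff']
    · refine ⟨Eventually.of_forall fun q => ?_, ?_⟩
      · simp only [Function.uncurry]
        refine Integrable.mul_const ?_ _
        simp only [hKdef, heisKernel_symm hJn _ q]
        exact hKi q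
      · have : ∀ q, ∫ p, ‖Function.uncurry (fun p q => K p q * w q ^ 2) (p, q)‖ =
            (∫ h, ‖J h‖) * w q ^ 2 := by
          intro q
          simp only [Function.uncurry, norm_mul, hKdef, heisKernel_symm hJn _ q]
          rw [integral_mul_const, integral_comp_heisKernel_right hJc continuous_norm q]
          simp
        simp only [this]
        exact hw2.const_mul _
    · exact hK.aestronglyMeasurable.mul
        ((hw.aestronglyMeasurable.comp_snd).pow 2)
  have hlast : ∫ p, ∫ q, K p q * w q ^ 2 = ∫ q, w q ^ 2 := by
    rw [integral_integral_swap hprod]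
    congr 1
    ext q
    rw [integral_mul_const]
    simp only [hKdef, heisKernel_symm hJn _ q]
    rw [hK1, one_mul]
  rw [dirichletForm]
  simp only [← hKdef, hinner]
  have hs : Integrable (fun p => w p ^ 2 - 2 * (k p * w p)) := hw2.sub (hkw.const_mul 2)
  have hs' : Integrable (fun p => ∫ q, K p q * w q ^ 2) := hprod.integral_prod_left
  rw [integral_add hs hs',
    integral_sub hw2 (hkw.const_mul 2), integral_const_mul, hlast,
    setIntegral_of_eq_zero (f := fun p => w p ^ 2) (fun q hq => by simp [hw0 q hq]),
    setIntegral_of_eq_zero (f := fun p => k p * w p) (fun q hq => by simp [hw0 q hq])]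
  ring

variable [IsFiniteMeasure (volume.restrict Ω)]

theorem dirichletForm_eq_of_ae_eq (hJc : Continuous J)
    (hJn : ∀ h, J (-h) = J h) (hJi : Integrable J) (hJ1 : ∫ h, J h = 1) (hΩ : MeasurableSet Ω)
    (hS : IsCompact (closure Ω)) {w : Heis n → ℝ}
    (hw : MemLp w 2) (hw0 : ∀ p ∉ Ω, w p = 0) {x : Lp ℝ 2 (volume.restrict Ω)}
    (hx : w =ᵐ[volume.restrict Ω] x) :
    (∫ p in Ω, w p ^ 2) = ‖x‖ ^ 2 ∧
    dirichletForm J w = ‖x‖ ^ 2 -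
      inner ℝ (kernelOpL2 (continuous_heisKernel hJc) hS (ae_restrict_mem_closure hΩ) x) x := by
  have h1 : (∫ p in Ω, w p ^ 2) = ‖x‖ ^ 2 := by
    rw [← real_inner_self_eq_norm_sq, L2.inner_def]
    refine integral_congr_ae ?_
    filter_upwards [hx] with p hp
    simp [hp, pow_two]
  refine ⟨h1, ?_⟩
  rw [dirichletForm_eq hJc hJn hJi hJ1 hΩ hS hw hw0, h1, inner_kernelOpL2]
  congr 1
  refine integral_congr_ae ?_
  filter_upwards [hx] with p hp
  rw [hp]
  congr 1
  refine integral_congr_ae ?_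
  filter_upwards [hx] with q hq
  rw [hq]

/-- The quotient depends only on the class of `w` on `Ω`; conversely each class is represented by
its extension by zero. -/
theorem firstEigenvalue_eq (hJc : Continuous J)
    (hJn : ∀ h, J (-h) = J h) (hJi : Integrable J) (hJ1 : ∫ h, J h = 1) (hΩ : MeasurableSet Ω)
    (hS : IsCompact (closure Ω)) :
    firstEigenvalue J Ω = sInf {r : ℝ | ∃ x : Lp ℝ 2 (volume.restrict Ω), x ≠ 0 ∧ r = 1 -
      inner ℝ (kernelOpL2 (continuous_heisKernel hJc) hS (ae_restrict_mem_closure hΩ) x) x /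
        ‖x‖ ^ 2} := by
  rw [firstEigenvalue]
  congr 1
  ext r
  constructor
  · rintro ⟨w, hw, hw0, hne, rfl⟩
    obtain ⟨h1, h2⟩ := dirichletForm_eq_of_ae_eq hJc hJn hJi hJ1 hΩ hS hw hw0
      (hw.restrict Ω).coeFn_toLp.symm
    refine ⟨(hw.restrict Ω).toLp w, ?_, ?_⟩
    · intro h0
      rw [h1, h0] at hne
      simp at hne
    · rw [h1] at hne
      rw [h1, h2, sub_div, div_self hne]
  · rintro ⟨x, hx, rfl⟩
    have hw : MemLp (Ω.indicator x) 2 := (memLp_indicator_iff_restrict hΩ).2 (Lp.memLp x)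
    have hw0 : ∀ p ∉ Ω, Ω.indicator x p = 0 := fun p hp => Set.indicator_of_notMem hp _
    obtain ⟨h1, h2⟩ := dirichletForm_eq_of_ae_eq hJc hJn hJi hJ1 hΩ hS hw hw0 (x := x)
      (indicator_ae_eq_restrict hΩ)
    have hne : ‖x‖ ^ 2 ≠ 0 := by positivity
    refine ⟨Ω.indicator x, hw, hw0, ?_, ?_⟩
    · rwa [h1]
    · rw [h1, h2, sub_div, div_self hne]

theorem inner_kernelOpL2_le_firstEigenvalue (hJc : Continuous J)
    (hJn : ∀ h, J (-h) = J h) (hJi : Integrable J) (hJ1 : ∫ h, J h = 1) (hΩ : MeasurableSet Ω)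
    (hS : IsCompact (closure Ω)) (x : Lp ℝ 2 (volume.restrict Ω)) :
    inner ℝ (kernelOpL2 (continuous_heisKernel hJc) hS (ae_restrict_mem_closure hΩ) x) x ≤
      (1 - firstEigenvalue J Ω) * ‖x‖ ^ 2 := by
  set A := kernelOpL2 (continuous_heisKernel hJc) hS (ae_restrict_mem_closure hΩ) with hA
  by_cases hx : x = 0
  · simp [hx]
  have hpos : 0 < ‖x‖ ^ 2 := by positivity
  rw [firstEigenvalue_eq hJc hJn hJi hJ1 hΩ hS, ← hA]
  -- The real infimum is a lower bound only for a set bounded below, here by `1 - ‖A‖`.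
  have hbdd : BddBelow {r : ℝ | ∃ x : Lp ℝ 2 (volume.restrict Ω), x ≠ 0 ∧ r = 1 -
      inner ℝ (A x) x / ‖x‖ ^ 2} := by
    refine ⟨1 - ‖A‖, ?_⟩
    rintro _ ⟨y, hy, rfl⟩
    have hpos : 0 < ‖y‖ ^ 2 := by positivity
    have : inner ℝ (A y) y ≤ ‖A‖ * ‖y‖ ^ 2 := by
      refine (real_inner_le_norm _ _).trans ?_
      rw [pow_two, ← mul_assoc]
      gcongr
      exact A.le_opNorm y
    rw [← div_le_iff₀ hpos] at this
    linarith
  have h := csInf_le hbdd ⟨x, hx, rfl⟩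
  rw [← div_le_iff₀ hpos]
  linarith

theorem exists_inner_kernelOpL2_ge_firstEigenvalue (hJc : Continuous J)
    (hJn : ∀ h, J (-h) = J h) (hJi : Integrable J) (hJ1 : ∫ h, J h = 1) (hΩ : MeasurableSet Ω)
    (hΩ0 : volume Ω ≠ 0) (hS : IsCompact (closure Ω)) {ε : ℝ} (hε : 0 < ε) :
    ∃ x : Lp ℝ 2 (volume.restrict Ω), x ≠ 0 ∧ (1 - firstEigenvalue J Ω - ε) * ‖x‖ ^ 2 ≤
      inner ℝ (kernelOpL2 (continuous_heisKernel hJc) hS (ae_restrict_mem_closure hΩ) x) x := by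
  set A := kernelOpL2 (continuous_heisKernel hJc) hS (ae_restrict_mem_closure hΩ) with hA
  rw [firstEigenvalue_eq hJc hJn hJi hJ1 hΩ hS, ← hA]
  have hne : {r : ℝ | ∃ x : Lp ℝ 2 (volume.restrict Ω), x ≠ 0 ∧ r = 1 -
      inner ℝ (A x) x / ‖x‖ ^ 2}.Nonempty := by
    refine ⟨_, Lp.const 2 (volume.restrict Ω) (1 : ℝ), ?_, rfl⟩
    intro h
    have h1 := Lp.coeFn_const (p := 2) (μ := volume.restrict Ω) (1 : ℝ)
    rw [h] at h1
    have h2 : ∀ᵐ p ∂(volume.restrict Ω), False := by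
      filter_upwards [h1, Lp.coeFn_zero ℝ 2 (volume.restrict Ω)] with p hp hp'
      rw [hp'] at hp
      simp at hp
    rw [eventually_false_iff_eq_bot, ae_eq_bot, Measure.restrict_eq_zero] at h2
    exact hΩ0 h2
  obtain ⟨_, ⟨x, hx, rfl⟩, hlt⟩ := Real.lt_sInf_add_pos hne hε
  refine ⟨x, hx, ?_⟩
  have hpos : 0 < ‖x‖ ^ 2 := by positivity
  rw [← le_div_iff₀ hpos]
  linarith

end HeisKernel

/-! ### Eigenfunctions, maximum principle and positivity -/

/-- The standing assumptions on the kernel `J` and the domain `Ω`. -/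
structure IsAdmissible {n : ℕ} (J : Heis n → ℝ) (Ω : Set (Heis n)) : Prop where
  continuous : Continuous J
  apply_neg : ∀ h, J (-h) = J h
  integrable : Integrable J
  integral_eq_one : ∫ h, J h = 1
  isOpen : IsOpen Ω
  isConnected : IsConnected Ω
  isCompact_closure : IsCompact (closure Ω)

namespace IsAdmissible

variable {n : ℕ} {J : Heis n → ℝ} {Ω : Set (Heis n)} [IsFiniteMeasure (volume.restrict Ω)]
  (h : IsAdmissible J Ω)

include h

theorem measurableSet : MeasurableSet Ω := h.isOpen.measurableSet

theorem volume_ne_zero : volume Ω ≠ 0 := (h.isOpen.measure_pos _ h.isConnected.nonempty).ne'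

theorem continuous_kernel : Continuous (Function.uncurry (heisKernel J)) :=
  continuous_heisKernel h.continuous

theorem continuous_kernel_right (p : Heis n) : Continuous (heisKernel J p) :=
  h.continuous_kernel.comp (Continuous.prodMk_right p)

theorem ae_mem_closure : ∀ᵐ p ∂(volume.restrict Ω), p ∈ closure Ω :=
  ae_restrict_mem_closure h.measurableSet

/-- The operator `J ∗ ·` on `L²(Ω)`. -/
abbrev opL2 : Lp ℝ 2 (volume.restrict Ω) →L[ℝ] Lp ℝ 2 (volume.restrict Ω) :=
  kernelOpL2 h.continuous_kernel h.isCompact_closure h.ae_mem_closure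

/-- The operator `J ∗ ·` from `L¹(Ω)` to `L^∞(Ω)`. -/
abbrev op : Lp ℝ 1 (volume.restrict Ω) →L[ℝ] Lp ℝ ∞ (volume.restrict Ω) :=
  kernelOp h.continuous_kernel h.isCompact_closure h.ae_mem_closure

theorem isSymmetric_opL2 : h.opL2.IsSymmetric :=
  isSymmetric_kernelOpL2 _ _ _ (heisKernel_symm h.apply_neg)

theorem isCompactOperator_opL2 : IsCompactOperator h.opL2 := isCompactOperator_kernelOpL2 _ _ _

theorem inner_opL2_le (x : Lp ℝ 2 (volume.restrict Ω)) :
    inner ℝ (h.opL2 x) x ≤ (1 - firstEigenvalue J Ω) * ‖x‖ ^ 2 :=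
  inner_kernelOpL2_le_firstEigenvalue h.continuous h.apply_neg h.integrable h.integral_eq_one
    h.measurableSet h.isCompact_closure x

theorem exists_eigenvector (hc : 0 < 1 - firstEigenvalue J Ω) :
    ∃ x, x ≠ 0 ∧ h.opL2 x = (1 - firstEigenvalue J Ω) • x :=
  exists_eigenvector_of_sup_inner h.isSymmetric_opL2 h.isCompactOperator_opL2 hc h.inner_opL2_le
    fun _ hε => exists_inner_kernelOpL2_ge_firstEigenvalue h.continuous h.apply_neg h.integrable
      h.integral_eq_one h.measurableSet h.volume_ne_zero h.isCompact_closure hε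

theorem continuous_kernelIntegral_L2 (y : Lp ℝ 2 (volume.restrict Ω)) :
    Continuous (kernelIntegral (heisKernel J) (volume.restrict Ω) y) :=
  continuous_kernelIntegral h.continuous_kernel h.isCompact_closure h.ae_mem_closure
    (integrable_coeFn_L2 y)

/-- For `c ≠ 0`, dividing by `c` yields a continuous representative of the eigenvector. -/
theorem kernelIntegral_ae_eq {c : ℝ} {y : Lp ℝ 2 (volume.restrict Ω)}
    (hy : h.opL2 y = c • y) :
    kernelIntegral (heisKernel J) (volume.restrict Ω) y =ᵐ[volume.restrict Ω] fun p => c * y p := by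
  have h1 : h.opL2 y =ᵐ[volume.restrict Ω] _ := coeFn_kernelOpL2 _ _ _ y
  rw [hy] at h1
  filter_upwards [h1, Lp.coeFn_smul c y] with p hp hp'
  rw [← hp, hp', Pi.smul_apply, smul_eq_mul]

theorem isFirstEigenfunction {y : Lp ℝ 2 (volume.restrict Ω)} (hy0 : y ≠ 0)
    (hy : h.opL2 y = (1 - firstEigenvalue J Ω) • y) {φ : Heis n → ℝ} (hφ : ∀ p ∉ Ω, φ p = 0)
    (hφy : φ =ᵐ[volume.restrict Ω] y) : IsFirstEigenfunction J Ω φ where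
  memLp := by
    have : MemLp φ 2 (volume.restrict Ω) := (memLp_congr_ae hφy).2 (Lp.memLp y)
    rwa [← memLp_indicator_iff_restrict h.measurableSet,
      Set.indicator_eq_self.2 (Function.support_subset_iff'.2 hφ)] at this
  eq_zero := hφ
  ne_zero := fun h0 => hy0 (by
    apply Lp.ext
    have h0' : φ =ᵐ[volume.restrict Ω] 0 := ae_restrict_of_ae h0
    exact (hφy.symm.trans h0').trans (Lp.coeFn_zero _ _ _).symm)
  equation := by
    filter_upwards [h.kernelIntegral_ae_eq hy, hφy] with p hp hp'
    rw [heisConv_of_eq_zero h.measurableSet hφ, kernelIntegral_congr_ae hφy, hp, hp']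
    ring

theorem exists_of_isFirstEigenfunction {φ : Heis n → ℝ} (hφ : IsFirstEigenfunction J Ω φ) :
    ∃ y : Lp ℝ 2 (volume.restrict Ω), y ≠ 0 ∧ h.opL2 y = (1 - firstEigenvalue J Ω) • y ∧
      φ =ᵐ[volume.restrict Ω] y := by
  have hy := (hφ.memLp.restrict Ω).coeFn_toLp
  refine ⟨(hφ.memLp.restrict Ω).toLp φ, fun h0 => hφ.ne_zero ?_, ?_, hy.symm⟩
  · rw [h0] at hy
    have h1 : φ =ᵐ[volume.restrict Ω] 0 := hy.symm.trans (Lp.coeFn_zero _ _ _)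
    have h2 := (ae_restrict_iff' h.measurableSet).1 h1
    filter_upwards [h2] with p hp
    by_cases hpΩ : p ∈ Ω
    · exact hp hpΩ
    · exact hφ.eq_zero p hpΩ
  · apply Lp.ext
    have h1 : h.opL2 ((hφ.memLp.restrict Ω).toLp φ) =ᵐ[volume.restrict Ω] _ :=
      coeFn_kernelOpL2 _ _ _ _
    filter_upwards [h1, Lp.coeFn_smul (1 - firstEigenvalue J Ω) ((hφ.memLp.restrict Ω).toLp φ), hy,
      hφ.equation] with p h1 h2 h3 h4
    rw [h1, h2, Pi.smul_apply, smul_eq_mul, h3, kernelIntegral_congr_ae hy,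
      ← heisConv_of_eq_zero h.measurableSet hφ.eq_zero]
    linarith

/-- A continuous non-negative function with zero integral on `Ω` vanishes on `Ω`. -/
theorem eq_zero_of_setIntegral_le_zero {f : Heis n → ℝ} (hf : ContinuousOn f Ω)
    (hi : IntegrableOn f Ω) (h0 : ∀ p ∈ Ω, 0 ≤ f p) (hint : ∫ p in Ω, f p ≤ 0) :
    ∀ p ∈ Ω, f p = 0 := by
  have h0' : 0 ≤ᵐ[volume.restrict Ω] f := by
    filter_upwards [ae_restrict_mem h.measurableSet] with p hp using h0 p hp
  have h1 : ∫ p in Ω, f p = 0 := le_antisymm hint (integral_nonneg_of_ae h0')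
  have h2 := (integral_eq_zero_iff_of_nonneg_ae h0' hi).1 h1
  exact Measure.eqOn_open_of_ae_eq h2 h.isOpen hf continuousOn_const

theorem kernelIntegral_integrableOn {g : Heis n → ℝ} (hg : Continuous g) (p : Heis n) :
    IntegrableOn (fun q => heisKernel J p q * g q) Ω := by
  refine integrable_kernel_mul h.continuous_kernel h.isCompact_closure h.ae_mem_closure ?_ p
  exact (hg.continuousOn.integrableOn_compact h.isCompact_closure).mono_set subset_closure

/-- Maximum principle: a non-negative `g` with `g ≤ ∫_Ω J(p q⁻¹) g(q) dq` vanishes on `Ω`. -/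
theorem eq_zero_of_le_kernelIntegral (hJ : ∀ a, 0 ≤ J a) {g : Heis n → ℝ} (hg : Continuous g)
    (hg0 : ∀ p, 0 ≤ g p)
    (hle : ∀ p, g p ≤ kernelIntegral (heisKernel J) (volume.restrict Ω) g p) :
    ∀ p ∈ closure Ω, g p = 0 := by
  obtain ⟨p₁, hp₁, hmax⟩ := h.isCompact_closure.exists_isMaxOn h.isConnected.nonempty.closure
    hg.continuousOn
  rcases (hg0 p₁).eq_or_lt with h0 | hM
  · exact fun p hp => le_antisymm (by rw [h0]; exact hmax hp) (hg0 p)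
  exfalso
  set M := g p₁ with hMdef
  set Z := closure Ω ∩ {q | g q = M} with hZdef
  have hZclosed : IsClosed {q | g q = M} := isClosed_eq hg continuous_const
  have hZ : IsCompact Z := h.isCompact_closure.inter_right hZclosed
  have hstep : ∀ p ∈ Z, ∀ q, 0 < heisKernel J p q → q ∈ Z := by
    intro p hp
    have hKi : Integrable (fun q => heisKernel J p q) := integrable_heisKernel_right h.integrable p
    have hK1 : ∫ q, heisKernel J p q = 1 := by
      rw [← h.integral_eq_one]
      exact integral_comp_heisKernel_right h.continuous continuous_id p
    have hind : Integrable (fun q => heisKernel J p q * Ω.indicator g q) := by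
      refine integrable_of_restrict (Ω := Ω) (fun q hq => by simp [hq]) ?_
      refine (h.kernelIntegral_integrableOn hg p).congr ?_
      filter_upwards [ae_restrict_mem h.measurableSet] with q hq
      rw [Set.indicator_of_mem hq]
    have hval : ∫ q, heisKernel J p q * Ω.indicator g q =
        kernelIntegral (heisKernel J) (volume.restrict Ω) g p :=
      heisConv_indicator h.measurableSet g p
    have hi : Integrable (fun q => M * heisKernel J p q - heisKernel J p q * Ω.indicator g q) :=
      (hKi.const_mul M).sub hind
    -- At a maximum point, `M - (J ∗ g)(p) ≤ 0` is the integral of a non-negative function, so `1_Ω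
    -- g = M` almost everywhere that the kernel is positive.
    have hle2 : ∫ q, (M * heisKernel J p q - heisKernel J p q * Ω.indicator g q) ≤ 0 := by
      rw [integral_sub (hKi.const_mul M) hind, integral_const_mul, hK1, hval]
      have := hle p
      rw [hp.2] at this
      linarith
    have hnn : ∀ q, 0 ≤ M * heisKernel J p q - heisKernel J p q * Ω.indicator g q := by
      intro q
      have hJq : 0 ≤ heisKernel J p q := hJ _
      have : Ω.indicator g q ≤ M := by
        by_cases hq : q ∈ Ω
        · rw [Set.indicator_of_mem hq]; exact hmax (subset_closure hq)
        · rw [Set.indicator_of_notMem hq]; exact hM.le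
      nlinarith
    have hz := (integral_eq_zero_iff_of_nonneg hnn hi).1
      (le_antisymm hle2 (integral_nonneg hnn))
    -- The exceptional set is open and null, hence empty: this removes the "almost".
    have hopen : IsOpen ({q | 0 < heisKernel J p q} ∩ Zᶜ) :=
      (isOpen_lt continuous_const (h.continuous_kernel_right p)).inter hZ.isClosed.isOpen_compl
    have hnull : volume ({q | 0 < heisKernel J p q} ∩ Zᶜ) = 0 := by
      refine measure_mono_null ?_ (ae_iff.1 hz)
      rintro q ⟨hq, hqZ⟩ hq0
      simp only [Pi.zero_apply] at hq0
      have hq : 0 < heisKernel J p q := hq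
      have hq1 : Ω.indicator g q = M := by
        have : heisKernel J p q * (M - Ω.indicator g q) = 0 := by linarith
        have := (mul_eq_zero.1 this).resolve_left hq.ne'
        linarith
      by_cases hqΩ : q ∈ Ω
      · rw [Set.indicator_of_mem hqΩ] at hq1
        exact hqZ ⟨subset_closure hqΩ, hq1⟩
      · rw [Set.indicator_of_notMem hqΩ] at hq1
        exact hM.ne hq1
    intro q hq
    by_contra hqZ
    have := (hopen.measure_eq_zero_iff volume).1 hnull
    exact Set.eq_empty_iff_forall_notMem.1 this q ⟨hq, hqZ⟩
  have hsupp : ∀ a, a ≠ 0 → J a = 0 := by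
    intro a ha
    by_contra hJa
    exact ha (eq_zero_of_heisKernel_mapsTo hZ ⟨p₁, hp₁, rfl⟩ hstep ((hJ a).lt_of_ne' hJa))
  have hae : J =ᵐ[volume] 0 := by
    have : ∀ᵐ a : Heis n, a ≠ 0 := by
      have h0 : ({0} : Set (Heis n)) = {0} ×ˢ {0} := by simp [← Prod.zero_eq_mk]
      have : volume ({0} : Set (Heis n)) = 0 := by
        rw [h0, Measure.volume_eq_prod, Measure.prod_prod, Real.volume_singleton, mul_zero]
      simpa [ae_iff] using this
    filter_upwards [this] with a ha using hsupp a ha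
  have := h.integral_eq_one
  rw [integral_congr_ae hae] at this
  simp at this

/-- If `λ₁ ≤ 0`, then `c ≥ 1` has an eigenvector `y` with `|y| = |J ∗ y| / c ≤ |J ∗ y|`. Thus `g =
|J ∗ y|` satisfies `g ≤ J ∗ g`, and the maximum principle kills it. -/
theorem firstEigenvalue_pos (hJ : ∀ a, 0 ≤ J a) : 0 < firstEigenvalue J Ω := by
  by_contra! hle
  set c := 1 - firstEigenvalue J Ω with hc
  have hc1 : 1 ≤ c := by linarith
  have hc0 : 0 < c := by linarith
  obtain ⟨y, hy0, hy⟩ := h.exists_eigenvector hc0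
  set k := kernelIntegral (heisKernel J) (volume.restrict Ω) y with hk
  have hkc : Continuous k := h.continuous_kernelIntegral_L2 y
  have hky := h.kernelIntegral_ae_eq hy
  have hz := h.eq_zero_of_le_kernelIntegral hJ (g := fun p => |k p|) hkc.abs
    (fun p => abs_nonneg _) (fun p => ?_)
  · apply hy0
    apply Lp.ext
    filter_upwards [hky, h.ae_mem_closure, Lp.coeFn_zero ℝ 2 (volume.restrict Ω)] with p hp hp2 hp0
    rw [hp0]
    have := abs_eq_zero.1 (hz p hp2)
    rw [hk, hp] at this
    exact (mul_eq_zero.1 this).resolve_left hc0.ne'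
  · simp only [hk, kernelIntegral, ← Real.norm_eq_abs]
    refine (norm_integral_le_integral_norm _).trans ?_
    refine integral_mono_ae (integrable_kernel_mul h.continuous_kernel h.isCompact_closure
      h.ae_mem_closure (integrable_coeFn_L2 y) p).norm
      (h.kernelIntegral_integrableOn hkc.norm p) ?_
    filter_upwards [hky] with q hq
    change ‖heisKernel J p q * y q‖ ≤
      heisKernel J p q * ‖kernelIntegral (heisKernel J) (volume.restrict Ω) y q‖
    have hKpq : 0 ≤ heisKernel J p q := hJ _
    rw [hq, ← hc, norm_mul, norm_mul, Real.norm_of_nonneg hKpq, Real.norm_of_nonneg hc0.le]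
    have : 0 ≤ heisKernel J p q * ‖y q‖ := mul_nonneg (hJ _) (norm_nonneg _)
    nlinarith

/-- If the top of the spectrum of `J ∗ ·` is not positive, then the kernel vanishes on `Ω × Ω`. -/
theorem heisKernel_eq_zero (hJ : ∀ a, 0 ≤ J a) (hc : 1 - firstEigenvalue J Ω ≤ 0) :
    ∀ p ∈ Ω, ∀ q ∈ Ω, heisKernel J p q = 0 := by
  -- Testing with the constant `1` gives `∫∫ K ≤ c ‖1‖² ≤ 0` over `Ω × Ω`.
  set x := Lp.const 2 (volume.restrict Ω) (1 : ℝ) with hx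
  have hx1 : x =ᵐ[volume.restrict Ω] fun _ => 1 := Lp.coeFn_const _ _ _
  have h1 := h.inner_opL2_le x
  rw [inner_kernelOpL2, kernelIntegral_congr_ae hx1] at h1
  set k := kernelIntegral (heisKernel J) (volume.restrict Ω) (fun _ => 1) with hk
  have hkc : Continuous k := by
    rw [hk, ← kernelIntegral_congr_ae hx1]
    exact h.continuous_kernelIntegral_L2 x
  have hk0 : ∀ p, 0 ≤ k p := fun p =>
    kernelIntegral_nonneg (fun p q => hJ _) (Eventually.of_forall fun _ => zero_le_one) p
  have h2 : ∫ p in Ω, k p * x p = ∫ p in Ω, k p := by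
    refine integral_congr_ae ?_
    filter_upwards [hx1] with p hp
    rw [hp, mul_one]
  rw [h2] at h1
  have h3 := h.eq_zero_of_setIntegral_le_zero hkc.continuousOn
    ((hkc.continuousOn.integrableOn_compact h.isCompact_closure).mono_set subset_closure)
    (fun p _ => hk0 p) (h1.trans (mul_nonpos_of_nonpos_of_nonneg hc (by positivity)))
  intro p hp
  refine h.eq_zero_of_setIntegral_le_zero (h.continuous_kernel_right p).continuousOn
    (integrable_heisKernel_right h.integrable p).integrableOn (fun q _ => hJ _) ?_
  have := h3 p hp
  simp only [hk, kernelIntegral, mul_one] at this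
  exact this.le

theorem op_eq_zero (hJ : ∀ a, 0 ≤ J a) (hc : 1 - firstEigenvalue J Ω ≤ 0) : h.op = 0 := by
  ext1 f
  apply Lp.ext
  have h1 : h.op f =ᵐ[volume.restrict Ω] _ := coeFn_kernelOp _ _ _ f
  filter_upwards [h1, ae_restrict_mem h.measurableSet,
    Lp.coeFn_zero ℝ ∞ (volume.restrict Ω)] with p hp hpΩ hp0
  rw [hp, zero_apply, hp0]
  refine (integral_congr_ae (g := fun _ => 0) ?_).trans (by simp)
  filter_upwards [ae_restrict_mem h.measurableSet] with q hq
  rw [h.heisKernel_eq_zero hJ hc p hpΩ q hq, zero_mul]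

theorem one_sub_firstEigenvalue_eq_zero (hJ : ∀ a, 0 ≤ J a) (hc : 1 - firstEigenvalue J Ω ≤ 0) :
    1 - firstEigenvalue J Ω = 0 := by
  refine le_antisymm hc ?_
  set x := Lp.const 2 (volume.restrict Ω) (1 : ℝ) with hx
  have hx1 : x =ᵐ[volume.restrict Ω] fun _ => 1 := Lp.coeFn_const _ _ _
  have hxne : x ≠ 0 := by
    intro h0
    rw [h0] at hx1
    have h2 : ∀ᵐ p ∂(volume.restrict Ω), False := by
      filter_upwards [hx1, Lp.coeFn_zero ℝ 2 (volume.restrict Ω)] with p hp hp'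
      rw [hp'] at hp
      simp at hp
    rw [eventually_false_iff_eq_bot, ae_eq_bot, Measure.restrict_eq_zero] at h2
    exact h.volume_ne_zero h2
  have h1 := h.inner_opL2_le x
  have h2 : h.opL2 x = 0 := by
    change lpInclusion _ le_top (h.op _) = 0
    rw [h.op_eq_zero hJ hc]; simp
  rw [h2, inner_zero_left] at h1
  have : 0 < ‖x‖ ^ 2 := by positivity
  exact nonneg_of_mul_nonneg_left h1 this

/-- Passing to `|y|` keeps the norm and does not lower the form, so `|y|` is again a maximizer and
hence an eigenvector. -/
theorem abs_eigenvector (hJ : ∀ a, 0 ≤ J a) {y : Lp ℝ 2 (volume.restrict Ω)}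
    (hy : h.opL2 y = (1 - firstEigenvalue J Ω) • y) :
    h.opL2 |y| = (1 - firstEigenvalue J Ω) • |y| := by
  refine apply_eq_smul_of_inner_ge h.isSymmetric_opL2 h.inner_opL2_le ?_
  refine le_trans (le_of_eq ?_) (inner_kernelOpL2_le_abs _ _ _ (fun p q => hJ _) y)
  change _ = inner ℝ (h.opL2 y) y
  rw [hy, inner_smul_left, real_inner_self_eq_norm_sq, norm_abs_eq_norm]
  simp

/-- If `J` charges the identity, an eigenvector whose continuous representative vanishes at a
point of `Ω` is zero. -/
theorem eq_zero_of_kernelIntegral_eq_zero (hJ : ∀ a, 0 ≤ J a) (hJ0 : 0 < J 0)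
    (hc : 0 < 1 - firstEigenvalue J Ω) {y : Lp ℝ 2 (volume.restrict Ω)}
    (hy : h.opL2 y = (1 - firstEigenvalue J Ω) • y) {p₀ : Heis n} (hp₀ : p₀ ∈ Ω)
    (hyp : kernelIntegral (heisKernel J) (volume.restrict Ω) y p₀ = 0) : y = 0 := by
  set c := 1 - firstEigenvalue J Ω with hcdef
  set k := kernelIntegral (heisKernel J) (volume.restrict Ω) (|y| : Lp ℝ 2 (volume.restrict Ω))
    with hk
  have hkc : Continuous k := h.continuous_kernelIntegral_L2 |y|
  have hk0 : ∀ p, 0 ≤ k p := fun p => kernelIntegral_nonneg (fun p q => hJ _)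
    ((Lp.coeFn_nonneg |y|).2 (abs_nonneg y)) p
  have hky : k =ᵐ[volume.restrict Ω] fun p => c * (|y| : Lp ℝ 2 (volume.restrict Ω)) p :=
    h.kernelIntegral_ae_eq (h.abs_eigenvector hJ hy)
  have hkp : k p₀ = 0 := by
    have h1 : k =ᵐ[volume.restrict Ω]
        fun p => |kernelIntegral (heisKernel J) (volume.restrict Ω) y p| := by
      filter_upwards [hky, h.kernelIntegral_ae_eq hy, Lp.coeFn_abs y] with p h1 h2 h3
      rw [h1, h2, h3, abs_mul, abs_of_pos hc]
    have h2 := Measure.eqOn_open_of_ae_eq h1 h.isOpen hkc.continuousOn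
      (h.continuous_kernelIntegral_L2 y).abs.continuousOn
    refine (h2 hp₀).trans ?_
    simp only [hyp, abs_zero]
  -- At a zero `p` of `k`, `∫_Ω K(p, q) k(q) dq = c k(p) = 0`, while `J 0 > 0` makes `K(p, ·)`
  -- positive near `p`.
  have hloc : ∀ p ∈ Ω, k p = 0 → ∀ᶠ q in 𝓝 p, k q = 0 := by
    intro p hp hkp
    have hint : ∫ q in Ω, heisKernel J p q * k q = 0 := by
      have : ∫ q in Ω, heisKernel J p q * k q = c * k p := by
        rw [hk]
        simp only [kernelIntegral]
        rw [← integral_const_mul]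
        refine integral_congr_ae ?_
        filter_upwards [hky] with q hq
        rw [hk] at hq
        simp only [kernelIntegral] at hq
        rw [hq]; ring
      rw [this, hkp, mul_zero]
    have hz := h.eq_zero_of_setIntegral_le_zero ((h.continuous_kernel_right p).mul hkc).continuousOn
      (h.kernelIntegral_integrableOn hkc p) (fun q _ => mul_nonneg (hJ _) (hk0 q)) hint.le
    have hpos : ∀ᶠ q in 𝓝 p, 0 < heisKernel J p q :=
      (h.continuous_kernel_right p).continuousAt.eventually (lt_mem_nhds (by rwa [heisKernel_self]))
    filter_upwards [hpos, h.isOpen.mem_nhds hp] with q hq hqΩ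
    exact (mul_eq_zero.1 (hz q hqΩ)).resolve_left hq.ne'
  have hU : IsOpen {p | p ∈ Ω ∧ k p = 0} := by
    rw [isOpen_iff_mem_nhds]
    rintro p ⟨hp, hkp⟩
    filter_upwards [hloc p hp hkp, h.isOpen.mem_nhds hp] with q h1 h2 using ⟨h2, h1⟩
  have hV : IsOpen {p | 0 < k p} := isOpen_lt continuous_const hkc
  have hdisj : Disjoint {p | p ∈ Ω ∧ k p = 0} {p | 0 < k p} :=
    Set.disjoint_left.2 fun p hp hp' => hp'.ne' hp.2
  have hcover : Ω ⊆ {p | p ∈ Ω ∧ k p = 0} ∪ {p | 0 < k p} := fun p hp => by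
    rcases (hk0 p).eq_or_lt with h0 | h0
    · exact Or.inl ⟨hp, h0.symm⟩
    · exact Or.inr h0
  have hzero : ∀ p ∈ Ω, k p = 0 := by
    rcases h.isConnected.isPreconnected.subset_or_subset hU hV hdisj hcover with h1 | h1
    · exact fun p hp => (h1 hp).2
    · exact absurd hkp (h1 hp₀).ne'
  have : |y| = 0 := by
    apply Lp.ext
    filter_upwards [hky, ae_restrict_mem h.measurableSet,
      Lp.coeFn_zero ℝ 2 (volume.restrict Ω)] with p hp hpΩ hp0
    rw [hp0]
    rw [hzero p hpΩ] at hp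
    exact (mul_eq_zero.1 hp.symm).resolve_left hc.ne'
  rw [← norm_eq_zero, ← norm_abs_eq_norm, this, norm_zero]

end IsAdmissible

/-! ### Decay and large-time asymptotics of solutions -/

theorem eLpNorm_coeFn_eq_ofReal_norm {X : Type*} [MeasurableSpace X] {μ : Measure X} {p : ℝ≥0∞}
    (f : Lp ℝ p μ) : eLpNorm f p μ = ENNReal.ofReal ‖f‖ := by
  rw [Lp.norm_def, ENNReal.ofReal_toReal (Lp.eLpNorm_ne_top f)]

namespace IsAdmissible

variable {n : ℕ} {J : Heis n → ℝ} {Ω : Set (Heis n)} [IsFiniteMeasure (volume.restrict Ω)]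
  (h : IsAdmissible J Ω)

include h

/-- The operator `J ∗ ·` on `L¹(Ω)`. -/
abbrev opL1 : Lp ℝ 1 (volume.restrict Ω) →L[ℝ] Lp ℝ 1 (volume.restrict Ω) :=
  kernelOpL1 h.continuous_kernel h.isCompact_closure h.ae_mem_closure

/-- The operator `J ∗ ·` on `L^∞(Ω)`. -/
abbrev opLinfty : Lp ℝ ∞ (volume.restrict Ω) →L[ℝ] Lp ℝ ∞ (volume.restrict Ω) :=
  kernelOpLinfty h.continuous_kernel h.isCompact_closure h.ae_mem_closure

/-- Solutions are given by the semigroup of any realization `B` of `J ∗ ·` on `L^p(Ω)`. -/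
theorem solution_eq {u₀ : Heis n → ℝ} {u : ℝ → Lp ℝ 1 (volume.restrict Ω)}
    (hu : IsDirichletSolution J Ω u₀ u) {p : ℝ≥0∞} [Fact (1 ≤ p)]
    (B : Lp ℝ p (volume.restrict Ω) →L[ℝ] Lp ℝ p (volume.restrict Ω))
    (hB : ∀ f, lpInclusion _ Fact.out (B f) = h.opL1 (lpInclusion _ Fact.out f))
    (U : Lp ℝ p (volume.restrict Ω)) (hU : U =ᵐ[volume.restrict Ω] u₀) {t : ℝ} (ht : 0 ≤ t) :
    u t = lpInclusion _ Fact.out (Real.exp (-t) • NormedSpace.exp (t • B) U) := by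
  rw [map_smul, map_exp_smul_apply B h.opL1 (lpInclusion _ Fact.out) hB U ht]
  have h0 : u 0 = lpInclusion _ Fact.out U := by
    apply Lp.ext
    rw [coeFn_lpInclusion]
    exact (show u 0 =ᵐ[volume.restrict Ω] u₀ from hu.initial).trans hU.symm
  rw [← h0]
  refine eq_exp_neg_smul_exp_smul_apply h.opL1 u hu.continuousOn (fun s hs => ?_) ht
  obtain ⟨v, hv, hd⟩ := hu.equation s hs
  refine hd.congr_deriv (Lp.ext ?_)
  have h1 : h.opL1 (u s) =ᵐ[volume.restrict Ω] _ := coeFn_kernelOpL1 _ _ _ (u s)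
  filter_upwards [hv, h1, Lp.coeFn_sub (h.opL1 (u s)) (u s)] with q hq h1 h2
  rw [h2, Pi.sub_apply, h1, hq, heisConv_indicator h.measurableSet]

theorem eLpNorm_two_solution_le {u₀ : Heis n → ℝ} {u : ℝ → Lp ℝ 1 (volume.restrict Ω)}
    (hu : IsDirichletSolution J Ω u₀ u) (hu₀ : MemLp u₀ 2 (volume.restrict Ω)) {t : ℝ}
    (ht : 0 ≤ t) :
    eLpNorm (u t) 2 (volume.restrict Ω) ≤
      ENNReal.ofReal (Real.exp (-(firstEigenvalue J Ω) * t)) *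
        eLpNorm u₀ 2 (volume.restrict Ω) := by
  have hU := hu₀.coeFn_toLp
  rw [h.solution_eq hu h.opL2 (fun _ => rfl) _ hU ht, coeFn_lpInclusion,
    eLpNorm_coeFn_eq_ofReal_norm, ← eLpNorm_congr_ae hU, eLpNorm_coeFn_eq_ofReal_norm,
    ← ENNReal.ofReal_mul (Real.exp_pos _).le]
  refine ENNReal.ofReal_le_ofReal ?_
  rw [norm_smul, Real.norm_eq_abs, Real.abs_exp]
  refine (mul_le_mul_of_nonneg_left (norm_exp_smul_apply_le h.inner_opL2_le _ ht)
    (Real.exp_pos _).le).trans (le_of_eq ?_)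
  rw [← mul_assoc, ← Real.exp_add]
  congr 2
  ring

/-- The rescaled semigroup on `L²(Ω)` applied to a positive function converges to a nonzero
non-negative eigenvector. -/
theorem exists_tendsto_L2 (hJ : ∀ a, 0 ≤ J a) (hc : 0 < 1 - firstEigenvalue J Ω)
    {x : Lp ℝ 2 (volume.restrict Ω)} (hx : ∀ᵐ p ∂(volume.restrict Ω), 0 < x p) :
    ∃ y, y ≠ 0 ∧ 0 ≤ y ∧ h.opL2 y = (1 - firstEigenvalue J Ω) • y ∧
      Tendsto (fun t : ℝ => Real.exp (-((1 - firstEigenvalue J Ω) * t)) •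
        NormedSpace.exp (t • h.opL2) x) atTop (𝓝 y) := by
  obtain ⟨y, hy, hinner, hlim⟩ := exists_tendsto_exp_smul_apply h.isSymmetric_opL2
    h.isCompactOperator_opL2 h.inner_opL2_le x
  have hx0 : 0 ≤ x := by
    rw [← Lp.coeFn_nonneg]
    filter_upwards [hx] with p hp using hp.le
  refine ⟨y, ?_, ?_, hy, hlim⟩
  · rintro rfl
    obtain ⟨ψ, hψ0, hψ⟩ := h.exists_eigenvector hc
    -- Were the limit zero, `x > 0` would be orthogonal to the non-negative eigenvector `|ψ|`,
    -- forcing `ψ = 0`.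
    have h1 := hinner |ψ| (h.abs_eigenvector hJ hψ)
    rw [inner_zero_left, L2.inner_def] at h1
    apply hψ0
    have hnn : 0 ≤ᵐ[volume.restrict Ω]
        fun p => inner ℝ (x p) ((|ψ| : Lp ℝ 2 (volume.restrict Ω)) p) := by
      filter_upwards [hx, Lp.coeFn_abs ψ] with p hp hp'
      rw [hp']
      simp only [RCLike.inner_apply, conj_trivial]
      positivity
    have h2 := (integral_eq_zero_iff_of_nonneg_ae hnn (L2.integrable_inner _ _)).1 h1.symm
    apply Lp.ext
    filter_upwards [h2, hx, Lp.coeFn_abs ψ, Lp.coeFn_zero ℝ 2 (volume.restrict Ω)]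
      with p hp hp1 hp2 hp3
    rw [hp3]
    rw [hp2] at hp
    simp only [RCLike.inner_apply, conj_trivial] at hp
    exact abs_eq_zero.1 ((mul_eq_zero.1 hp).resolve_right hp1.ne')
  · refine ge_of_tendsto hlim ?_
    filter_upwards [eventually_ge_atTop 0] with t ht
    have h1 := (Lp.coeFn_nonneg _).2
      (exp_smul_kernelOpL2_nonneg h.continuous_kernel h.isCompact_closure h.ae_mem_closure
        (fun p q => hJ _) hx0 ht)
    rw [← Lp.coeFn_nonneg]
    filter_upwards [h1, Lp.coeFn_smul (Real.exp (-((1 - firstEigenvalue J Ω) * t)))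
      (NormedSpace.exp (t • h.opL2) x)] with p hp hp'
    rw [hp']
    exact mul_nonneg (Real.exp_pos _).le hp

/-- Convergence in `L²` of the rescaled semigroup upgrades to convergence in `L^∞`. -/
theorem tendsto_Linfty_of_tendsto_L2 {c : ℝ} (hc : 0 < c) {y : Lp ℝ 2 (volume.restrict Ω)}
    (hy : h.opL2 y = c • y) {U Φ : Lp ℝ ∞ (volume.restrict Ω)}
    (hΦ : lpInclusion _ le_top Φ = y)
    (hlim : Tendsto (fun t : ℝ => Real.exp (-(c * t)) •
      NormedSpace.exp (t • h.opL2) (lpInclusion _ le_top U)) atTop (𝓝 y)) :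
    Tendsto (fun t : ℝ => Real.exp (-(c * t)) • NormedSpace.exp (t • h.opLinfty) U)
      atTop (𝓝 Φ) := by
  set i : Lp ℝ ∞ (volume.restrict Ω) →L[ℝ] Lp ℝ 2 (volume.restrict Ω) :=
    lpInclusion _ le_top with hi
  have hcomm : ∀ f, i (h.opLinfty f) = h.opL2 (i f) := fun _ => rfl
  have hΦeig : h.opLinfty Φ = c • Φ := by
    apply lpInclusion_injective (le_top : (2 : ℝ≥0∞) ≤ ∞)
    change i _ = i _
    rw [hcomm, map_smul, hΦ, hy]
  set T : Lp ℝ 2 (volume.restrict Ω) →L[ℝ] Lp ℝ ∞ (volume.restrict Ω) :=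
    h.op.comp (lpInclusion _ one_le_two) with hT
  have hTi : ∀ f, h.opLinfty f = T (i f) := fun _ => rfl
  have hexpΦ : ∀ t : ℝ, 0 ≤ t →
      Real.exp (-(c * t)) • NormedSpace.exp (t • h.opLinfty) Φ = Φ := by
    intro t ht
    rw [exp_smul_apply_eigenvector h.opLinfty hΦeig ht, smul_smul, ← Real.exp_add]
    simp
  have hexpy : ∀ t : ℝ, 0 ≤ t →
      Real.exp (-(c * t)) • NormedSpace.exp (t • h.opL2) y = y := by
    intro t ht
    rw [exp_smul_apply_eigenvector h.opL2 hy ht, smul_smul, ← Real.exp_add]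
    simp
  have hmain : Tendsto (fun t : ℝ => Real.exp (-(c * t)) •
      NormedSpace.exp (t • h.opLinfty) (U - Φ)) atTop (𝓝 0) := by
    -- The derivative is `T` applied to the `L²` semigroup, so `L²` convergence makes it `o(e^{ct})`
    -- in `L^∞`. Integration preserves this since `c > 0`.
    refine tendsto_exp_smul_of_hasDerivAt hc
      (fun t _ => hasDerivAt_exp_smul_apply h.opLinfty (U - Φ) t) ?_
    have h0 : Tendsto (fun t : ℝ => ‖T‖ * ‖Real.exp (-(c * t)) •
        NormedSpace.exp (t • h.opL2) (i U) - y‖) atTop (𝓝 0) := by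
      have := ((hlim.sub_const y).norm).const_mul ‖T‖
      simpa using this
    refine squeeze_zero' (Eventually.of_forall fun t => by positivity) ?_ h0
    filter_upwards [eventually_ge_atTop 0] with t ht
    have h1 : Real.exp (-(c * t)) • h.opLinfty (NormedSpace.exp (t • h.opLinfty) (U - Φ)) =
        T (Real.exp (-(c * t)) • NormedSpace.exp (t • h.opL2) (i U) - y) := by
      rw [hTi, ← map_smul, map_exp_smul_apply h.opLinfty h.opL2 i hcomm _ ht, map_sub, map_sub,
        hΦ, smul_sub, hexpy t ht]
    have h2 : Real.exp (-(c * t)) * ‖h.opLinfty (NormedSpace.exp (t • h.opLinfty) (U - Φ))‖ =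
        ‖Real.exp (-(c * t)) • h.opLinfty (NormedSpace.exp (t • h.opLinfty) (U - Φ))‖ := by
      rw [norm_smul, Real.norm_eq_abs, Real.abs_exp]
    rw [h2, h1]
    exact T.le_opNorm _
  have h3 : Tendsto (fun t : ℝ => Real.exp (-(c * t)) •
      NormedSpace.exp (t • h.opLinfty) (U - Φ) + Φ) atTop (𝓝 Φ) := by
    simpa using hmain.add_const Φ
  refine h3.congr' ?_
  filter_upwards [eventually_ge_atTop 0] with t ht
  rw [map_sub, smul_sub, hexpΦ t ht, sub_add_cancel]

theorem exists_tendsto_Linfty (hJ : ∀ a, 0 ≤ J a) {u₀ : Heis n → ℝ} (hu₀ : ContinuousOn u₀ Ω)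
    (hpos : ∀ p ∈ Ω, 0 < u₀ p) {U : Lp ℝ ∞ (volume.restrict Ω)}
    (hU : U =ᵐ[volume.restrict Ω] u₀) :
    ∃ (φ : Heis n → ℝ) (Φ : Lp ℝ ∞ (volume.restrict Ω)), IsFirstEigenfunction J Ω φ ∧
      ContinuousOn φ Ω ∧ (∀ p, 0 ≤ φ p) ∧ Φ =ᵐ[volume.restrict Ω] φ ∧
      Tendsto (fun t : ℝ => Real.exp (-((1 - firstEigenvalue J Ω) * t)) •
        NormedSpace.exp (t • h.opLinfty) U) atTop (𝓝 Φ) := by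
  have hUpos : ∀ᵐ p ∂(volume.restrict Ω), 0 < U p := by
    filter_upwards [hU, ae_restrict_mem h.measurableSet] with p hp hpΩ
    rw [hp]; exact hpos p hpΩ
  rcases lt_or_ge 0 (1 - firstEigenvalue J Ω) with hc | hc
  · set c := 1 - firstEigenvalue J Ω with hcdef
    obtain ⟨y, hy0, hynn, hy, hlim⟩ := h.exists_tendsto_L2 hJ hc
      (x := lpInclusion _ le_top U) hUpos
    set k := kernelIntegral (heisKernel J) (volume.restrict Ω) y with hk
    have hkc : Continuous k := h.continuous_kernelIntegral_L2 y
    have hk0 : ∀ p, 0 ≤ k p := fun p =>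
      kernelIntegral_nonneg (fun p q => hJ _) ((Lp.coeFn_nonneg y).2 hynn) p
    have hky : k =ᵐ[volume.restrict Ω] fun p => c * y p := h.kernelIntegral_ae_eq hy
    have hφy : Ω.indicator (fun p => c⁻¹ * k p) =ᵐ[volume.restrict Ω] y := by
      filter_upwards [hky, ae_restrict_mem h.measurableSet] with p hp hpΩ
      rw [Set.indicator_of_mem hpΩ, hp, inv_mul_cancel_left₀ hc.ne']
    have hΦy : lpInclusion _ le_top (c⁻¹ • h.op (lpInclusion _ one_le_two y)) = y := by
      rw [map_smul]
      change c⁻¹ • h.opL2 y = y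
      rw [hy, inv_smul_smul₀ hc.ne']
    refine ⟨Ω.indicator (fun p => c⁻¹ * k p), c⁻¹ • h.op (lpInclusion _ one_le_two y),
      h.isFirstEigenfunction hy0 hy (fun p hp => Set.indicator_of_notMem hp _) hφy, ?_, ?_, ?_,
      h.tendsto_Linfty_of_tendsto_L2 hc hy hΦy hlim⟩
    · refine ContinuousOn.congr (f := fun p => c⁻¹ * k p) (by fun_prop) ?_
      exact fun p hp => Set.indicator_of_mem hp _
    · exact fun p => Set.indicator_nonneg (fun p _ => mul_nonneg (inv_pos.2 hc).le (hk0 p)) p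
    · have h1 := coeFn_lpInclusion (le_top : (2 : ℝ≥0∞) ≤ ∞)
        (c⁻¹ • h.op (lpInclusion _ one_le_two y))
      rw [← h1, hΦy]
      exact hφy.symm
  -- Degenerate case: `J ∗ ·` is zero on `Ω`, the rescaled semigroup is the identity, and the limit
  -- is `u₀`.
  · have h0 := h.one_sub_firstEigenvalue_eq_zero hJ hc
    have hφU : Ω.indicator u₀ =ᵐ[volume.restrict Ω] U :=
      (indicator_ae_eq_restrict h.measurableSet).trans hU.symm
    have hop : h.opLinfty = 0 := by
      ext1 f
      change h.op _ = 0
      rw [h.op_eq_zero hJ hc]; rfl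
    have hopL2 : ∀ f, h.opL2 f = 0 := fun f => by
      change lpInclusion _ le_top (h.op _) = 0
      rw [h.op_eq_zero hJ hc, zero_apply, map_zero]
    refine ⟨Ω.indicator u₀, U, h.isFirstEigenfunction (y := lpInclusion _ le_top U) ?_ ?_
      (fun p hp => Set.indicator_of_notMem hp _) hφU, ?_, ?_, hφU.symm, ?_⟩
    · intro hU0
      have hU1 : ∀ᵐ p ∂(volume.restrict Ω), U p = 0 := by
        have := Lp.coeFn_zero ℝ 2 (volume.restrict Ω)
        rw [← hU0] at this
        exact this
      have h2 : ∀ᵐ p ∂(volume.restrict Ω), False := by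
        filter_upwards [hU1, hUpos] with p hp hp'
        exact hp'.ne' hp
      rw [eventually_false_iff_eq_bot, ae_eq_bot, Measure.restrict_eq_zero] at h2
      exact h.volume_ne_zero h2
    · rw [hopL2, h0, zero_smul]
    · exact hu₀.congr fun p hp => Set.indicator_of_mem hp _
    · exact fun p => Set.indicator_nonneg (fun p hp => (hpos p hp).le) p
    · rw [h0, hop]
      simp

theorem memLp_top_of_continuousOn {u₀ : Heis n → ℝ} (hu₀ : ContinuousOn u₀ Ω)
    (hpos : ∀ p ∈ Ω, 0 < u₀ p) (hbdd : ∃ M : ℝ, ∀ p ∈ Ω, u₀ p ≤ M) :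
    MemLp u₀ ∞ (volume.restrict Ω) := by
  obtain ⟨M, hM⟩ := hbdd
  refine memLp_top_of_bound (hu₀.aestronglyMeasurable h.measurableSet) M ?_
  filter_upwards [ae_restrict_mem h.measurableSet] with p hp
  rw [Real.norm_of_nonneg (hpos p hp).le]
  exact hM p hp

theorem asymptotics (hJ : ∀ a, 0 ≤ J a) {u₀ : Heis n → ℝ}
    {u : ℝ → Lp ℝ 1 (volume.restrict Ω)} (hu₀ : ContinuousOn u₀ Ω)
    (hpos : ∀ p ∈ Ω, 0 < u₀ p) (hbdd : ∃ M : ℝ, ∀ p ∈ Ω, u₀ p ≤ M)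
    (hu : IsDirichletSolution J Ω u₀ u) :
    (∃ C : ℝ, 0 < C ∧ ∀ t : ℝ, 0 ≤ t →
      eLpNorm (u t) ∞ (volume.restrict Ω) ≤
        ENNReal.ofReal (C * Real.exp (-(firstEigenvalue J Ω) * t))) ∧
    (∃ φ : Heis n → ℝ, IsFirstEigenfunction J Ω φ ∧ ContinuousOn φ Ω ∧
      (∀ p, 0 ≤ φ p) ∧
      Tendsto (fun t : ℝ =>
        eLpNorm (fun p => Real.exp (firstEigenvalue J Ω * t) * u t p - φ p) ∞
          (volume.restrict Ω)) atTop (𝓝 0)) := by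
  have hm := h.memLp_top_of_continuousOn hu₀ hpos hbdd
  have hU := hm.coeFn_toLp
  set U := hm.toLp u₀ with hUdef
  obtain ⟨φ, Φ, hφ, hφc, hφ0, hΦφ, hlim⟩ := h.exists_tendsto_Linfty hJ hu₀ hpos hU
  set v : ℝ → Lp ℝ ∞ (volume.restrict Ω) := fun t =>
    Real.exp (-((1 - firstEigenvalue J Ω) * t)) • NormedSpace.exp (t • h.opLinfty) U with hv
  have hut : ∀ t, 0 ≤ t → (u t : Heis n → ℝ) =ᵐ[volume.restrict Ω]
      (Real.exp (-(firstEigenvalue J Ω) * t) • v t : Lp ℝ ∞ (volume.restrict Ω)) := by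
    intro t ht
    rw [h.solution_eq hu h.opLinfty (fun _ => rfl) _ hU ht, coeFn_lpInclusion, hv, smul_smul,
      ← Real.exp_add]
    have : -t = -(firstEigenvalue J Ω) * t + -((1 - firstEigenvalue J Ω) * t) := by ring
    rw [← this]
  refine ⟨?_, φ, hφ, hφc, hφ0, ?_⟩
  · have hvc : Continuous v := by
      have hexp : Continuous fun t : ℝ => Real.exp (-((1 - firstEigenvalue J Ω) * t)) := by
        fun_prop
      refine hexp.smul ?_
      exact continuous_iff_continuousAt.2 fun t =>
        (hasDerivAt_exp_smul_apply h.opLinfty U t).continuousAt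
    -- Convergence bounds `v` after time `T`, continuity bounds it on `[0, T]`.
    obtain ⟨T, hT⟩ := Metric.tendsto_atTop.1 hlim 1 one_pos
    obtain ⟨B, hB⟩ := (isCompact_Icc (a := (0 : ℝ)) (b := T)).exists_bound_of_continuousOn
      hvc.continuousOn
    have hvb : ∀ t, 0 ≤ t → ‖v t‖ ≤ max B 0 + (‖Φ‖ + 1) := by
      intro t ht
      rcases le_total t T with htT | htT
      · have := hB t ⟨ht, htT⟩
        have := le_max_left B 0
        have := norm_nonneg Φ
        linarith
      · have h1 : ‖v t - Φ‖ < 1 := by rw [← dist_eq_norm]; exact hT t htT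
        have h2 := norm_le_norm_add_norm_sub' (v t) Φ
        have := le_max_right B 0
        linarith
    refine ⟨max B 0 + (‖Φ‖ + 1), ?_, fun t ht => ?_⟩
    · have := le_max_right B 0
      positivity
    · rw [eLpNorm_congr_ae (hut t ht), eLpNorm_coeFn_eq_ofReal_norm]
      refine ENNReal.ofReal_le_ofReal ?_
      rw [norm_smul, Real.norm_eq_abs, Real.abs_exp, mul_comm]
      exact mul_le_mul_of_nonneg_right (hvb t ht) (Real.exp_pos _).le
  · have h1 : Tendsto (fun t => ENNReal.ofReal ‖v t - Φ‖) atTop (𝓝 0) := by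
      have := ENNReal.tendsto_ofReal (tendsto_iff_norm_sub_tendsto_zero.1 hlim)
      simpa using this
    refine h1.congr' ?_
    filter_upwards [eventually_ge_atTop 0] with t ht
    rw [← eLpNorm_coeFn_eq_ofReal_norm]
    refine eLpNorm_congr_ae ?_
    filter_upwards [hut t ht, Lp.coeFn_sub (v t) Φ, hΦφ,
      Lp.coeFn_smul (Real.exp (-(firstEigenvalue J Ω) * t)) (v t)] with p h1 h2 h3 h4
    rw [h2, Pi.sub_apply, h3, h1, h4, Pi.smul_apply, smul_eq_mul, ← mul_assoc, ← Real.exp_add]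
    simp

theorem one_sub_firstEigenvalue_pos (hJ : ∀ a, 0 ≤ J a) (hJ0 : 0 < J 0) :
    0 < 1 - firstEigenvalue J Ω := by
  by_contra! hc
  obtain ⟨p, hp⟩ := h.isConnected.nonempty
  have h1 := h.heisKernel_eq_zero hJ hc p hp p hp
  rw [heisKernel_self] at h1
  exact hJ0.ne' h1

/-- If `J` charges the identity, the first eigenfunction is unique up to constants. -/
theorem exists_smul_eq_of_eigenvector (hJ : ∀ a, 0 ≤ J a) (hJ0 : 0 < J 0)
    {x y : Lp ℝ 2 (volume.restrict Ω)} (hx0 : x ≠ 0)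
    (hx : h.opL2 x = (1 - firstEigenvalue J Ω) • x)
    (hy : h.opL2 y = (1 - firstEigenvalue J Ω) • y) : ∃ c : ℝ, y = c • x := by
  have hc := h.one_sub_firstEigenvalue_pos hJ hJ0
  obtain ⟨p, hp⟩ := h.isConnected.nonempty
  set a := kernelIntegral (heisKernel J) (volume.restrict Ω) x p with ha
  set b := kernelIntegral (heisKernel J) (volume.restrict Ω) y p with hb
  have ha0 : a ≠ 0 := fun h0 => hx0 (h.eq_zero_of_kernelIntegral_eq_zero hJ hJ0 hc hx hp h0)
  -- With this ratio the continuous function `J ∗ (y - (b / a) x)` vanishes at `p`.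
  refine ⟨b / a, sub_eq_zero.1 (h.eq_zero_of_kernelIntegral_eq_zero hJ hJ0 hc ?_ hp ?_)⟩
  · rw [map_sub, map_smul, hx, hy, smul_sub, smul_comm]
  · have h1 : (y - (b / a) • x : Lp ℝ 2 (volume.restrict Ω)) =ᵐ[volume.restrict Ω]
        fun q => y q - b / a * x q := by
      filter_upwards [Lp.coeFn_sub y ((b / a) • x), Lp.coeFn_smul (b / a) x] with q h1 h2
      rw [h1, Pi.sub_apply, h2, Pi.smul_apply, smul_eq_mul]
    have hint : ∀ z : Lp ℝ 2 (volume.restrict Ω), IntegrableOn (fun q => heisKernel J p q * z q) Ω :=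
      fun z => integrable_kernel_mul h.continuous_kernel h.isCompact_closure h.ae_mem_closure
        (integrable_coeFn_L2 z) p
    rw [kernelIntegral_congr_ae h1]
    have h2 : kernelIntegral (heisKernel J) (volume.restrict Ω)
        (fun q => y q - b / a * x q) p = b - b / a * a := by
      rw [ha, hb]
      simp only [kernelIntegral]
      rw [← integral_const_mul, ← integral_sub (hint y) ((hint x).const_mul _)]
      congr 1
      ext q
      ring
    rw [h2, div_mul_cancel₀ _ ha0, sub_self]

/-- The absolute value of any eigenvector works: its continuous representative has no zero in `Ω`,
and simplicity gives uniqueness. -/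
theorem exists_unique_positive_eigenfunction (hJ : ∀ a, 0 ≤ J a) (hJ0 : 0 < J 0) :
    ∃ φ : Heis n → ℝ, IsFirstEigenfunction J Ω φ ∧ ContinuousOn φ Ω ∧ (∀ p ∈ Ω, 0 < φ p) ∧
      ∀ ψ : Heis n → ℝ, IsFirstEigenfunction J Ω ψ →
        ∃ c : ℝ, ∀ᵐ p ∂(volume.restrict Ω), ψ p = c * φ p := by
  have hc := h.one_sub_firstEigenvalue_pos hJ hJ0
  obtain ⟨x, hx0, hx⟩ := h.exists_eigenvector hc
  have hax := h.abs_eigenvector hJ hx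
  set c := 1 - firstEigenvalue J Ω with hcdef
  set y : Lp ℝ 2 (volume.restrict Ω) := |x| with hydef
  have hy0 : y ≠ 0 := by
    rw [← norm_ne_zero_iff, hydef, norm_abs_eq_norm]
    exact norm_ne_zero_iff.2 hx0
  set k := kernelIntegral (heisKernel J) (volume.restrict Ω) y with hk
  have hkc : Continuous k := h.continuous_kernelIntegral_L2 y
  have hk0 : ∀ p ∈ Ω, 0 < k p := fun p hp =>
    (kernelIntegral_nonneg (fun p q => hJ _) ((Lp.coeFn_nonneg y).2 (abs_nonneg x)) p).lt_of_ne'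
      fun h0 => hy0 (h.eq_zero_of_kernelIntegral_eq_zero hJ hJ0 hc hax hp h0)
  have hky : k =ᵐ[volume.restrict Ω] fun p => c * y p := h.kernelIntegral_ae_eq hax
  have hφy : Ω.indicator (fun p => c⁻¹ * k p) =ᵐ[volume.restrict Ω] y := by
    filter_upwards [hky, ae_restrict_mem h.measurableSet] with p hp hpΩ
    rw [Set.indicator_of_mem hpΩ, hp, inv_mul_cancel_left₀ hc.ne']
  refine ⟨Ω.indicator (fun p => c⁻¹ * k p),
    h.isFirstEigenfunction hy0 hax (fun p hp => Set.indicator_of_notMem hp _) hφy, ?_, ?_, ?_⟩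
  · refine ContinuousOn.congr (f := fun p => c⁻¹ * k p) (by fun_prop) ?_
    exact fun p hp => Set.indicator_of_mem hp _
  · intro p hp
    rw [Set.indicator_of_mem hp]
    exact mul_pos (inv_pos.2 hc) (hk0 p hp)
  · intro ψ hψ
    obtain ⟨z, -, hz, hψz⟩ := h.exists_of_isFirstEigenfunction hψ
    obtain ⟨r, hr⟩ := h.exists_smul_eq_of_eigenvector hJ hJ0 hy0 hax hz
    refine ⟨r, ?_⟩
    rw [hr] at hψz
    filter_upwards [hψz, hφy, Lp.coeFn_smul r y] with p h1 h2 h3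
    rw [h1, h2, h3, Pi.smul_apply, smul_eq_mul]

end IsAdmissible

end

/-! ### The main theorem -/

theorem HypH.isAdmissible {n : ℕ} {Ω : Set (Heis n)} {J : Heis n → ℝ} (hJ : HypH J)
    (hΩo : IsOpen Ω) (hΩc : IsConnected Ω) (hΩb : Bornology.IsBounded Ω) (hJc : Continuous J)
    (hJs : ∀ (z : Fin n → ℂ) (s : ℝ), J (z, -s) = J (z, s)) : IsAdmissible J Ω where
  continuous := hJc
  apply_neg := hJ.apply_neg hJs
  integrable := hJ.integrable
  integral_eq_one := hJ.integral_eq_one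
  isOpen := hΩo
  isConnected := hΩc
  isCompact_closure := hΩb.isCompact_closure

theorem theorem2 (n : ℕ) (Ω : Set (Heis n)) (hΩo : IsOpen Ω) (hΩc : IsConnected Ω)
    (hΩb : Bornology.IsBounded Ω) (J : Heis n → ℝ) (hJc : Continuous J) (hJ : HypH J)
    (hJs : ∀ (z : Fin n → ℂ) (s : ℝ), J (z, -s) = J (z, s)) :
    -- decay in `L²(Ω)` for data in `L¹(Ω) ∩ L²(Ω)`
    (∀ (u₀ : Heis n → ℝ) (u : ℝ → Lp ℝ 1 (volume.restrict Ω)),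
      MemLp u₀ 1 (volume.restrict Ω) → MemLp u₀ 2 (volume.restrict Ω) →
      IsDirichletSolution J Ω u₀ u →
      ∀ t : ℝ, 0 ≤ t →
        eLpNorm (u t) 2 (volume.restrict Ω) ≤
          ENNReal.ofReal (Real.exp (-(firstEigenvalue J Ω) * t)) *
            eLpNorm u₀ 2 (volume.restrict Ω)) ∧
    ((∀ p, 0 ≤ J p) →
      -- the rate is exponential decay to zero
      0 < firstEigenvalue J Ω ∧
      -- continuous, positive, bounded data: `L^∞` decay and convergence to an eigenfunction
      (∀ (u₀ : Heis n → ℝ) (u : ℝ → Lp ℝ 1 (volume.restrict Ω)),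
        ContinuousOn u₀ Ω → (∀ p ∈ Ω, 0 < u₀ p) → (∃ M : ℝ, ∀ p ∈ Ω, u₀ p ≤ M) →
        IsDirichletSolution J Ω u₀ u →
        (∃ C : ℝ, 0 < C ∧ ∀ t : ℝ, 0 ≤ t →
          eLpNorm (u t) ∞ (volume.restrict Ω) ≤
            ENNReal.ofReal (C * Real.exp (-(firstEigenvalue J Ω) * t))) ∧
        (∃ (φ : Heis n → ℝ) (C' : ℝ), IsFirstEigenfunction J Ω φ ∧ ContinuousOn φ Ω ∧
          (∀ p, 0 ≤ φ p) ∧ 0 < C' ∧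
          Tendsto (fun t : ℝ =>
            eLpNorm (fun p => Real.exp (firstEigenvalue J Ω * t) * u t p - C' * φ p) ∞
              (volume.restrict Ω)) atTop (𝓝 0))) ∧
      -- if `J` does not vanish at the identity, there is one eigenfunction `φ₁` up to constants,
      -- it is positive, and it describes the asymptotic behaviour of all these solutions
      (0 < J 0 →
        ∃ φ₁ : Heis n → ℝ, IsFirstEigenfunction J Ω φ₁ ∧ ContinuousOn φ₁ Ω ∧
          (∀ p ∈ Ω, 0 < φ₁ p) ∧
          (∀ ψ : Heis n → ℝ, IsFirstEigenfunction J Ω ψ →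
            ∃ c : ℝ, ∀ᵐ p ∂(volume.restrict Ω), ψ p = c * φ₁ p) ∧
          (∀ (u₀ : Heis n → ℝ) (u : ℝ → Lp ℝ 1 (volume.restrict Ω)),
            ContinuousOn u₀ Ω → (∀ p ∈ Ω, 0 < u₀ p) → (∃ M : ℝ, ∀ p ∈ Ω, u₀ p ≤ M) →
            IsDirichletSolution J Ω u₀ u →
            ∃ C' : ℝ, 0 < C' ∧
              Tendsto (fun t : ℝ =>
                eLpNorm (fun p => Real.exp (firstEigenvalue J Ω * t) * u t p - C' * φ₁ p) ∞
                  (volume.restrict Ω)) atTop (𝓝 0)))) := by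
  have : IsFiniteMeasure (volume.restrict Ω) :=
    isFiniteMeasure_restrict.2 hΩb.measure_lt_top.ne
  have h := hJ.isAdmissible hΩo hΩc hΩb hJc hJs
  refine ⟨fun u₀ u _ hu₀ hu t ht => h.eLpNorm_two_solution_le hu hu₀ ht, fun hJp =>
    ⟨h.firstEigenvalue_pos hJp, fun u₀ u hu₀ hpos hbdd hu => ?_, fun hJ0 => ?_⟩⟩
  · obtain ⟨hdecay, φ, hφ, hφc, hφ0, hlim⟩ := h.asymptotics hJp hu₀ hpos hbdd hu
    -- Here `φ` may depend on `u₀` and already carries the constant.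
    exact ⟨hdecay, φ, 1, hφ, hφc, hφ0, one_pos, by simpa using hlim⟩
  · obtain ⟨φ₁, hφ₁, hφ₁c, hφ₁pos, huniq⟩ := h.exists_unique_positive_eigenfunction hJp hJ0
    refine ⟨φ₁, hφ₁, hφ₁c, hφ₁pos, huniq, fun u₀ u hu₀ hpos hbdd hu => ?_⟩
    obtain ⟨-, φ, hφ, hφc, hφ0, hlim⟩ := h.asymptotics hJp hu₀ hpos hbdd hu
    obtain ⟨c, hc⟩ := huniq φ hφ
    have hcφ : ∀ p ∈ Ω, φ p = c * φ₁ p :=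
      Measure.eqOn_open_of_ae_eq hc hΩo hφc (continuousOn_const.mul hφ₁c)
    -- Otherwise `0 ≤ φ = c φ₁ ≤ 0` on `Ω`, contradicting `φ ≠ 0`.
    have hc0 : 0 < c := by
      by_contra! hc0
      refine hφ.ne_zero (Eventually.of_forall fun p => ?_)
      by_cases hp : p ∈ Ω
      · refine le_antisymm ?_ (hφ0 p)
        rw [hcφ p hp]
        exact mul_nonpos_of_nonpos_of_nonneg hc0 (hφ₁pos p hp).le
      · exact hφ.eq_zero p hp
    refine ⟨c, hc0, hlim.congr fun t => eLpNorm_congr_ae ?_⟩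
    filter_upwards [hc] with p hp
    rw [hp]
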